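/- **Uniform cosine and sine laws for generalized hyperbolic triangles.** *Generalized triangles.* Let $v_1,v_2,v_3$ be the vertices of a non-degenerate triangle $\widetilde\triangle$ in the projective plane containing the Klein model of $\mathbb H^2$, let $L_i$ be the geodesic of $\mathbb H^2$ on the side line opposite to $v_i$, and attach a horodisc to each ideal vertex. The type of $v_i$ is $\varepsilon_i=1,0,-1$ according as $v_i\in\mathbb H^2$, $v_i\in\partial\mathbb H^2$, or $v_i\notin\mathbb H^2\cup\partial\mathbb H^2$. Let $\triangle\subset\mathbb H^2$ be the polygon obtained from $\widetilde\triangle\cap\mathbb H^2$ by cutting off each vertex of type $-1$ along its polar geodesic, that is, the common perpendicular of the two sides through it. The data form a *generalized hyperbolic triangle* of type $(\varepsilon_1,\varepsilon_2,\varepsilon_3)\in\{-1,0,1\}^3$ if every $L_i\cap\triangle$ is a genuine edge (has more than one point). *Angles.* The generalized angle $\theta_i$ at $v_i$ is the inner angle if $\varepsilon_i=1$; twice the length of the part of the horocycle at $v_i$ lying in the cusp bounded by the two sides through $v_i$ if $\varepsilon_i=0$; and the distance of the two sides through $v_i$ if $\varepsilon_i=-1$. *Lengths.* Let $B_u$ be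 $\{u\}$, the horodisc at $u$, or the half plane missing $\triangle$ bounded by the polar geodesic of $u$, for a vertex $u$ of type $1,0,-1$ respectively (for type $-1$, $B_u$ contains its bounding geodesic, so it meets $\triangle$ only along that geodesic). If $u,w$ are the two vertices on $L_i$, the generalized length $l_i$ of the edge opposite to $v_i$ is the distance from $B_u$ to $B_w$ if $B_u\cap B_w=\emptyset$, and minus the distance from $\partial B_u\cap L_i$ to $\partial B_w\cap L_i$ otherwise. *Functions.* For $\varepsilon,s\in\{-1,0,1\}$ put $$\rho_\varepsilon(\theta)=\int_0^\theta\cos(\sqrt\varepsilon\,x)\,dx,\qquad \tau_s(l)=\tfrac12e^{l}-\tfrac12s\,e^{-l},$$ so $\rho_1=\sin$, $\rho_0(\theta)=\theta$, $\rho_{-1}=\sinh$, and let $\rho'_\varepsilon,\tau'_s$ be the derivatives in $\theta$ and in $l$. *Claim.* For every generalized hyperbolic triangle of any type $(\varepsilon_1,\varepsilon_2,\varepsilon_3)\in\{-1,0,1\}^3$, with generalized angles $\theta_1,\theta_2,\theta_3$ and opposite generalized edge lengths $l_1,l_2,l_3$, and for all $\{i,j,k\}=\{1,2,3\}$, the numbers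 $\rho_{\varepsilon_i}(\theta_i)$ and $\tau_{\varepsilon_j\varepsilon_k}(l_i)$ are non-zero and $$\tau'_{\varepsilon_j\varepsilon_k}(l_i)=\frac{\rho'_{\varepsilon_i}(\theta_i)+\rho'_{\varepsilon_j}(\theta_j)\rho'_{\varepsilon_k}(\theta_k)}{\rho_{\varepsilon_j}(\theta_j)\rho_{\varepsilon_k}(\theta_k)},$$ $$2\rho_{\varepsilon_i}^2\!\left(\tfrac{\theta_i}2\right)=\frac{\tau'_{\varepsilon_j\varepsilon_k}(l_i)-\frac12\varepsilon_je^{l_j-l_k}-\frac12\varepsilon_ke^{l_k-l_j}}{\tau_{\varepsilon_k\varepsilon_i}(l_j)\,\tau_{\varepsilon_i\varepsilon_j}(l_k)},$$ $$\rho'_{\varepsilon_i}(\theta_i)=\frac{-\varepsilon_i\tau'_{\varepsilon_j\varepsilon_k}(l_i)+\tau'_{\varepsilon_k\varepsilon_i}(l_j)\,\tau'_{\varepsilon_i\varepsilon_j}(l_k)}{\tau_{\varepsilon_k\varepsilon_i}(l_j)\,\tau_{\varepsilon_i\varepsilon_j}(l_k)},$$ $$\frac{\rho_{\varepsilon_i}(\theta_i)}{\tau_{\varepsilon_j\varepsilon_k}(l_i)}=\frac{\rho_{\varepsilon_j}(\theta_j)}{\tau_{\varepsilon_k\varepsilon_i}(l_j)}.$$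 -/

import Mathlib

open scoped Real

noncomputable section

/-! ### The functions `ρ` and `τ` -/

/-- `ρ_ε(θ) = ∫₀^θ cos(√ε x) dx`, the integrand being real for real `ε` (`√(-1)` is `I`). -/
def rho (ε θ : ℝ) : ℝ :=
  ∫ x in (0 : ℝ)..θ, (Complex.cos ((ε : ℂ) ^ (1 / 2 : ℂ) * (x : ℂ))).re

/-- `ρ'_ε(θ) = ∂ρ_ε(θ)/∂θ`. -/
def rho' (ε θ : ℝ) : ℝ := deriv (rho ε) θ

/-- `τ_s(l) = (e^l - s e^{-l})/2`. -/
def tau (s l : ℝ) : ℝ := 1 / 2 * Real.exp l - 1 / 2 * s * Real.exp (-l)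

/-- `τ'_s(l) = ∂τ_s(l)/∂l`. -/
def tau' (s l : ℝ) : ℝ := deriv (tau s) l

theorem rho_one (θ : ℝ) : rho 1 θ = Real.sin θ := by
  have h : ∀ x : ℝ, (Complex.cos (((1 : ℝ) : ℂ) ^ (1 / 2 : ℂ) * (x : ℂ))).re = Real.cos x := by
    intro x
    rw [Complex.ofReal_one, Complex.one_cpow, one_mul, Complex.cos_ofReal_re]
  simp only [rho, h, integral_cos, Real.sin_zero, sub_zero]

theorem rho_zero (θ : ℝ) : rho 0 θ = θ := by
  have h : ∀ x : ℝ, (Complex.cos (((0 : ℝ) : ℂ) ^ (1 / 2 : ℂ) * (x : ℂ))).re = 1 := by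
    intro x
    rw [Complex.ofReal_zero, Complex.zero_cpow (by norm_num), zero_mul, Complex.cos_zero,
      Complex.one_re]
  simp only [rho, h]
  simp

theorem rho_neg_one (θ : ℝ) : rho (-1) θ = Real.sinh θ := by
  have h : ∀ x : ℝ, (Complex.cos (((-1 : ℝ) : ℂ) ^ (1 / 2 : ℂ) * (x : ℂ))).re = Real.cosh x := by
    intro x
    have hI : ((-1 : ℝ) : ℂ) ^ (1 / 2 : ℂ) = Complex.I := by
      rw [Complex.cpow_def_of_ne_zero (by norm_num)]
      have : Complex.log ((-1 : ℝ) : ℂ) * (1 / 2 : ℂ) = (π : ℂ) / 2 * Complex.I := by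
        rw [Complex.ofReal_neg, Complex.ofReal_one, Complex.log_neg_one]; ring
      rw [this, Complex.exp_mul_I, Complex.cos_pi_div_two, Complex.sin_pi_div_two]
      ring
    rw [hI, mul_comm, Complex.cos_mul_I, Complex.cosh_ofReal_re]
  simp only [rho, h]
  rw [intervalIntegral.integral_eq_sub_of_hasDerivAt
    (fun x _ => Real.hasDerivAt_sinh x) (Real.continuous_cosh.intervalIntegrable _ _)]
  simp

theorem rho'_one (θ : ℝ) : rho' 1 θ = Real.cos θ := by
  have : rho 1 = Real.sin := funext rho_one
  rw [rho', this, Real.deriv_sin]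

theorem rho'_zero (θ : ℝ) : rho' 0 θ = 1 := by
  have : rho 0 = fun x => x := funext rho_zero
  rw [rho', this]
  simp

theorem rho'_neg_one (θ : ℝ) : rho' (-1) θ = Real.cosh θ := by
  have : rho (-1) = Real.sinh := funext rho_neg_one
  rw [rho', this, Real.deriv_sinh]

theorem tau'_eq (s l : ℝ) :
    tau' s l = 1 / 2 * Real.exp l + 1 / 2 * s * Real.exp (-l) := by
  have h : HasDerivAt (tau s)
      (1 / 2 * Real.exp l - 1 / 2 * s * (Real.exp (-l) * (-1))) l := by
    unfold tau
    exact ((Real.hasDerivAt_exp l).const_mul _).sub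
      (((hasDerivAt_neg l).exp).const_mul _)
  rw [tau', h.deriv]; ring

/-! ### The hyperbolic plane (hyperboloid model) -/

/-- The vectors of `ℝ^{2,1}`.  The coordinate `0` is the time coordinate; the nonzero vectors,
up to scaling, are the points of the projective plane that contains the Klein model. -/
abbrev Vec : Type := Fin 3 → ℝ

/-- The Lorentz form of `ℝ^{2,1}`. -/
def mink (x y : Vec) : ℝ := -(x 0 * y 0) + x 1 * y 1 + x 2 * y 2

/-- The hyperbolic plane `ℍ²`: the upper sheet of the hyperboloid. -/
def hypPlane : Set Vec := {x | mink x x = -1 ∧ 0 < x 0}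

/-- The hyperbolic distance: `cosh d(x, y) = -⟨x, y⟩`. -/
def hypDist (x y : Vec) : ℝ := Real.arcosh (-mink x y)

/-- The distance between two sets of points of `ℍ²`. -/
def setDist (A B : Set Vec) : ℝ := sInf {d | ∃ x ∈ A, ∃ y ∈ B, d = hypDist x y}

/-- The hyperbolic length of a `C¹` curve `γ : [0, 1] → ℍ²`; the Riemannian metric of `ℍ²` is the
restriction of the Lorentz form. -/
def curveLength (γ : ℝ → Vec) : ℝ :=
  ∫ t in (0 : ℝ)..1, Real.sqrt (mink (deriv γ t) (deriv γ t))

/-- The length of a simple `C¹` arc `A` in `ℍ²`: the length of any injective `C¹` curve that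
traces it out (all of these have the same length, and the infimum picks it). -/
def arcLength (A : Set Vec) : ℝ :=
  sInf {L | ∃ γ : ℝ → Vec, ContDiff ℝ 1 γ ∧ Set.InjOn γ (Set.Icc 0 1) ∧
    γ '' Set.Icc 0 1 = A ∧ L = curveLength γ}

/-- The point of `ℍ²` on the ray spanned by a future timelike vector. -/
def toHyp (v : Vec) : Vec := (Real.sqrt (-mink v v))⁻¹ • v

/-- The component of `x` tangent to `ℍ²` at `p ∈ ℍ²`.  It is the initial direction of the geodesic
that runs from `p` towards the projective point `x` through the points of `ℍ²` of the form
`a • p + b • x` with `a, b ≥ 0`. -/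
def tangentPart (p x : Vec) : Vec := x + mink x p • p

/-- The angle at `p ∈ ℍ²` between the geodesics from `p` towards `x` and towards `y`. -/
def hypAngle (p x y : Vec) : ℝ :=
  Real.arccos (mink (tangentPart p x) (tangentPart p y) /
    (Real.sqrt (mink (tangentPart p x) (tangentPart p x)) *
      Real.sqrt (mink (tangentPart p y) (tangentPart p y))))

/-! ### Generalized hyperbolic triangles -/

/-- The geodesic `L_i` opposite to the vertex `v i`: the trace on `ℍ²` of the projective line
through the other two vertices. -/
def sideLine (v : Fin 3 → Vec) (i : Fin 3) : Set Vec :=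
  {x | x ∈ hypPlane ∧ ∃ a b : ℝ, x = a • v (i + 1) + b • v (i + 2)}

/-- The polygon `Δ`: the part in `ℍ²` of the projective triangle with vertices `v 0, v 1, v 2`,
cut off, at each vertex outside the closed disc of the Klein model, along the polar geodesic of
that vertex (the common perpendicular of the two sides through it). -/
def polygon (v : Fin 3 → Vec) : Set Vec :=
  {x | x ∈ hypPlane ∧
    (∃ a : Fin 3 → ℝ, (∀ i, 0 ≤ a i) ∧ x = ∑ i, a i • v i) ∧
    ∀ i, 0 < mink (v i) (v i) → mink x (v i) ≤ 0}

/-- A generalized hyperbolic triangle, given by its three generalized vertices in homogeneous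
coordinates of the Klein model, and by a horodisc at each ideal vertex.
The vertex `v i` is in `ℍ²`, on the circle at infinity, or outside according as `⟨v i, v i⟩` is
negative, zero or positive. -/
structure GenTriangle where
  /-- The generalized vertices; the projective triangle is the cone on these vectors. -/
  v : Fin 3 → Vec
  /-- The triangle is not degenerate. -/
  indep : LinearIndependent ℝ v
  /-- The vertices in `ℍ²` and those at infinity are represented by future vectors. -/
  future : ∀ i, mink (v i) (v i) ≤ 0 → 0 < v i 0
  /-- The polygon is bounded by `L_0`, `L_1`, `L_2`: each of these geodesics carries a genuine
  edge `L_i ∩ Δ`. -/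
  edge_nontrivial : ∀ i, (sideLine v i ∩ polygon v).Nontrivial
  /-- The level of the horodisc `{x ∈ ℍ² | -⟨x, v i⟩ ≤ horo i}` at an ideal vertex; it is not
  used at the other vertices. -/
  horo : Fin 3 → ℝ
  horo_pos : ∀ i, mink (v i) (v i) = 0 → 0 < horo i

namespace GenTriangle

variable (T : GenTriangle)

/-- The type `ε_i` of a vertex: `1` in `ℍ²`, `0` at infinity, `-1` outside. -/
def type (i : Fin 3) : ℝ :=
  if mink (T.v i) (T.v i) < 0 then 1 else if mink (T.v i) (T.v i) = 0 then 0 else -1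

/-- The set `B_u` of a vertex `u`: the point `u`, the horodisc at `u`, or the half plane missing
`Δ` that is bounded by the polar geodesic of `u`. -/
def body (i : Fin 3) : Set Vec :=
  if mink (T.v i) (T.v i) < 0 then {toHyp (T.v i)}
  else if mink (T.v i) (T.v i) = 0 then {x | x ∈ hypPlane ∧ -mink x (T.v i) ≤ T.horo i}
  else {x | x ∈ hypPlane ∧ 0 ≤ mink x (T.v i)}

/-- The boundary `∂B_u`: the point `u`, the horocycle at `u`, or the polar geodesic of `u`. -/
def bodyBoundary (i : Fin 3) : Set Vec :=
  if mink (T.v i) (T.v i) < 0 then {toHyp (T.v i)}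
  else if mink (T.v i) (T.v i) = 0 then {x | x ∈ hypPlane ∧ -mink x (T.v i) = T.horo i}
  else {x | x ∈ hypPlane ∧ mink x (T.v i) = 0}

/-- The region at the vertex `v i` that is bounded by the two sides through `v i`: the
intersection of the half plane of each of these sides that contains the triangle.  At an ideal
vertex this is the cusp bounded by the two sides. -/
def sector (i : Fin 3) : Set Vec :=
  {x | x ∈ hypPlane ∧ ∃ a b c : ℝ, 0 ≤ b ∧ 0 ≤ c ∧
    x = a • T.v i + b • T.v (i + 1) + c • T.v (i + 2)}

/-- The generalized angle `θ_i` at the vertex `v i`: the inner angle if the vertex is in `ℍ²`,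
twice the length of the part of the horocycle in the cusp if the vertex is ideal, and the
distance of the two sides through the vertex if it is outside. -/
def angle (i : Fin 3) : ℝ :=
  if mink (T.v i) (T.v i) < 0 then hypAngle (toHyp (T.v i)) (T.v (i + 1)) (T.v (i + 2))
  else if mink (T.v i) (T.v i) = 0 then 2 * arcLength (T.bodyBoundary i ∩ T.sector i)
  else setDist (sideLine T.v (i + 1)) (sideLine T.v (i + 2))

open Classical in
/-- The generalized length `l_i` of the edge on `L_i`, which is opposite to the vertex `v i`. -/
def length (i : Fin 3) : ℝ :=
  if T.body (i + 1) ∩ T.body (i + 2) = ∅ then setDist (T.body (i + 1)) (T.body (i + 2))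
  else -setDist (T.bodyBoundary (i + 1) ∩ sideLine T.v i) (T.bodyBoundary (i + 2) ∩ sideLine T.v i)

end GenTriangle

end

noncomputable section

/-! ### The Lorentz form -/

/-! Everything is read off from one Gram matrix. Rescale the vertices to vectors `u_i` with `⟨u_i,
u_i⟩ = -ε_i`; at an ideal vertex, scale so that the horodisc is `-⟨x, u_i⟩ ≤ 1/2`. Put `c_i = -⟨u_j,
u_k⟩` (`gram`), `t_i = √(c_i² - ε_j ε_k)` (`minor`), and let `D` (`gramDet`) be the determinant of
the matrix `M` with diagonal `ε_i` and off-diagonal entries `c_i`. The genuine edges give `c_i > 0`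
and `c_i² > ε_j ε_k`; independence of the vertices gives `D > 0`.

The geometry is the dictionary `e^{l_i} = c_i + t_i`, `τ(l_i) = t_i`, `τ'(l_i) = c_i`, `ρ(θ_i) = √D
/ (t_j t_k)`, `ρ'(θ_i) = (c_j c_k - ε_i c_i) / (t_j t_k)`, whose form does not depend on the types.

For lengths (`length_eq`), the plane of an edge has a basis of future null vectors `p`, `m` in which
the vertices are `m + ε_j p` and `q p + ε_k q⁻¹ m`, with `q = c_i + t_i`. On the geodesic `e^t p +
e^{-t} m` the boundaries of the two bodies lie at `t = 0` and `t = log q`, and each body stays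
behind the perpendicular erected there. So `log q` is the signed distance for all nine pairs of
types at once.

For angles there is one computation per type: the angle between tangent vectors (`hypAngle_unit`),
the length of a parabolic arc (`arcLength_cusp`), and the common perpendicular of the two sides
(`setDist_sides`). The relation between `ρ` and `ρ'` is the diagonal part of `adj (adj M) = det M •
M` (`minor_sq_mul_minor_sq`); its off-diagonal part is the first cosine law. The remaining laws
follow by substituting the dictionary, with a double angle formula for the half-angle law. -/

theorem mink_comm (x y : Vec) : mink x y = mink y x := by
  simp only [mink]; ring

theorem mink_add_left (x y z : Vec) : mink (x + y) z = mink x z + mink y z := by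
  simp only [mink, Pi.add_apply]; ring

theorem mink_add_right (x y z : Vec) : mink x (y + z) = mink x y + mink x z := by
  simp only [mink, Pi.add_apply]; ring

theorem mink_sub_left (x y z : Vec) : mink (x - y) z = mink x z - mink y z := by
  simp only [mink, Pi.sub_apply]; ring

theorem mink_sub_right (x y z : Vec) : mink x (y - z) = mink x y - mink x z := by
  simp only [mink, Pi.sub_apply]; ring

theorem mink_smul_left (a : ℝ) (x y : Vec) : mink (a • x) y = a * mink x y := by
  simp only [mink, Pi.smul_apply, smul_eq_mul]; ring

theorem mink_smul_right (a : ℝ) (x y : Vec) : mink x (a • y) = a * mink x y := by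
  simp only [mink, Pi.smul_apply, smul_eq_mul]; ring

theorem mink_neg_right (x y : Vec) : mink x (-y) = -mink x y := by
  simp only [mink, Pi.neg_apply]; ring

/-- The orthogonal complement of a timelike vector is positive definite. -/
theorem mink_self_pos_of_orthogonal {p z : Vec} (hp : mink p p < 0) (h : mink z p = 0)
    (hz : z ≠ 0) : 0 < mink z z := by
  simp only [mink] at *
  have hp0 : 0 < p 0 ^ 2 := by nlinarith [sq_nonneg (p 1), sq_nonneg (p 2)]
  have hp0' : p 0 ≠ 0 := by rintro h0; simp [h0] at hp0
  have hpos : 0 < z 1 ^ 2 + z 2 ^ 2 := by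
    by_contra hn
    have h1 : z 1 = 0 := by nlinarith [sq_nonneg (z 1), sq_nonneg (z 2)]
    have h2 : z 2 = 0 := by nlinarith [sq_nonneg (z 1), sq_nonneg (z 2)]
    have h0 : z 0 = 0 := by
      have : z 0 * p 0 = 0 := by rw [h1, h2] at h; linarith
      exact (mul_eq_zero.1 this).resolve_right hp0'
    apply hz
    funext i
    fin_cases i <;> assumption
  -- Eliminate `z 0 * p 0` by orthogonality; what remains is Lagrange's identity in the space
  -- coordinates.
  have hid : p 0 ^ 2 * (-(z 0 * z 0) + z 1 * z 1 + z 2 * z 2) =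
      (p 0 ^ 2 - p 1 ^ 2 - p 2 ^ 2) * (z 1 ^ 2 + z 2 ^ 2) + (p 1 * z 2 - p 2 * z 1) ^ 2 := by
    have h' : z 0 * p 0 = z 1 * p 1 + z 2 * p 2 := by linarith
    linear_combination (-(z 0 * p 0) - (z 1 * p 1 + z 2 * p 2)) * h'
  have : 0 < p 0 ^ 2 * (-(z 0 * z 0) + z 1 * z 1 + z 2 * z 2) := by
    rw [hid]
    have : 0 < (p 0 ^ 2 - p 1 ^ 2 - p 2 ^ 2) * (z 1 ^ 2 + z 2 ^ 2) :=
      mul_pos (by nlinarith) hpos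
    positivity
  exact (mul_pos_iff_of_pos_left hp0).1 this

theorem mink_self_nonneg_of_orthogonal {p z : Vec} (hp : mink p p < 0) (h : mink z p = 0) :
    0 ≤ mink z z := by
  by_cases hz : z = 0
  · simp [hz, mink]
  · exact (mink_self_pos_of_orthogonal hp h hz).le

/-- The Cauchy-Schwarz inequality in the orthogonal complement of a timelike vector. -/
theorem mink_sq_le_of_orthogonal {p z w : Vec} (hp : mink p p < 0) (hz : mink z p = 0)
    (hw : mink w p = 0) : mink z w ^ 2 ≤ mink z z * mink w w := by
  by_cases h0 : w = 0
  · simp [h0, mink]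
  have hpos := mink_self_pos_of_orthogonal hp hw h0
  have h := mink_self_nonneg_of_orthogonal (z := mink w w • z - mink z w • w) hp
    (by simp only [mink_sub_left, mink_smul_left, hz, hw]; ring)
  simp only [mink_sub_left, mink_sub_right, mink_smul_left, mink_smul_right,
    mink_comm w z] at h
  have h' : 0 ≤ mink w w * (mink z z * mink w w - mink z w ^ 2) := by linarith
  linarith [(mul_nonneg_iff_of_pos_left hpos).1 h']

theorem mink_neg_of_future {x e : Vec} (hx : mink x x < 0) (hx0 : 0 < x 0) (he : mink e e ≤ 0)
    (he0 : 0 < e 0) : mink x e < 0 := by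
  simp only [mink] at *
  have h1 : x 1 ^ 2 + x 2 ^ 2 < x 0 ^ 2 := by linarith
  have h2 : e 1 ^ 2 + e 2 ^ 2 ≤ e 0 ^ 2 := by linarith
  have h3 : (x 1 * e 1 + x 2 * e 2) ^ 2 < (x 0 * e 0) ^ 2 := by
    have : (x 1 * e 1 + x 2 * e 2) ^ 2 ≤ (x 1 ^ 2 + x 2 ^ 2) * (e 1 ^ 2 + e 2 ^ 2) := by
      nlinarith [sq_nonneg (x 1 * e 2 - x 2 * e 1)]
    have h4 : (x 1 ^ 2 + x 2 ^ 2) * (e 1 ^ 2 + e 2 ^ 2) ≤ (x 1 ^ 2 + x 2 ^ 2) * e 0 ^ 2 := by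
      gcongr
    have h5 : (x 1 ^ 2 + x 2 ^ 2) * e 0 ^ 2 < x 0 ^ 2 * e 0 ^ 2 := by gcongr
    nlinarith
  have := lt_of_pow_lt_pow_left₀ 2 (by positivity) h3
  linarith

/-- The sign test that puts a constructed vector on the future side: a single known point of `ℍ²`
decides. -/
theorem future_of_mink_neg {x e : Vec} (hx : x ∈ hypPlane) (he : mink e e ≤ 0)
    (h : mink x e < 0) : 0 < e 0 := by
  by_contra hn
  rcases lt_or_eq_of_le (not_lt.1 hn) with h0 | h0
  · have := mink_neg_of_future (e := -e) (by rw [hx.1]; norm_num) hx.2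
      (by simpa [mink] using he) (by simpa using h0)
    rw [mink_neg_right] at this
    linarith
  · have h1 : e 1 = 0 := by
      simp only [mink, h0] at he; nlinarith [sq_nonneg (e 1), sq_nonneg (e 2)]
    have h2 : e 2 = 0 := by
      simp only [mink, h0] at he; nlinarith [sq_nonneg (e 1), sq_nonneg (e 2)]
    simp [mink, h0, h1, h2] at h

theorem mem_hypPlane_of_mink_neg {x y : Vec} (hx : x ∈ hypPlane) (hy : mink y y = -1)
    (h : mink x y < 0) : y ∈ hypPlane :=
  ⟨hy, future_of_mink_neg hx (by rw [hy]; norm_num) h⟩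

/-- The component of `x` orthogonal to `y` has square `⟨x, y⟩² - 1`, which cannot be negative; the
future condition selects the sign. -/
theorem mink_le_neg_one {x y : Vec} (hx : x ∈ hypPlane) (hy : y ∈ hypPlane) :
    mink x y ≤ -1 := by
  have hneg : mink x y < 0 := mink_neg_of_future (by rw [hx.1]; norm_num) hx.2
    (by rw [hy.1]; norm_num) hy.2
  have h := mink_self_nonneg_of_orthogonal (p := y) (z := x + mink x y • y)
    (by rw [hy.1]; norm_num) (by rw [mink_add_left, mink_smul_left, hy.1]; ring)
  simp only [mink_add_left, mink_add_right, mink_smul_left, mink_smul_right, hx.1, hy.1,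
    mink_comm y x] at h
  nlinarith

/-! ### Distances realised by a pair of points -/

theorem setDist_eq {A B : Set Vec} {x₀ y₀ : Vec} (hx₀ : x₀ ∈ A) (hy₀ : y₀ ∈ B)
    (h1 : mink x₀ y₀ ≤ -1) (h : ∀ x ∈ A, ∀ y ∈ B, mink x y ≤ mink x₀ y₀) :
    setDist A B = Real.arcosh (-mink x₀ y₀) := by
  refine IsLeast.csInf_eq ⟨⟨x₀, hx₀, y₀, hy₀, rfl⟩, ?_⟩
  rintro d ⟨x, hx, y, hy, rfl⟩
  have := h x hx y hy
  exact (Real.arcosh_le_arcosh (by linarith) (by linarith)).2 (by linarith)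

/-- The numerical core of `NullFrame.mink_le`: `(α, β)` and `(α', β')` are null coordinates of two
points, and `g` is the product of their components orthogonal to the frame. With `A = αβ'` and `B =
βα'`, the ratio `B / A ≥ q²` gives `A + B ≥ √(AB) (q + q⁻¹)`, while Cauchy-Schwarz gives `√(AB) ≥ 1
+ |g|`. The surplus `|g| (q + q⁻¹) ≥ 2|g|` absorbs `g`. -/
theorem le_half_plane_product {α β α' β' q g : ℝ} (pα : 0 < α) (pβ : 0 < β) (pα' : 0 < α')
    (pβ' : 0 < β') (hq : 1 ≤ q) (hαβ : α ≤ β) (hαβ' : q ^ 2 * β' ≤ α') (hzz : 0 ≤ α * β - 1)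
    (hww : 0 ≤ α' * β' - 1) (hcs : g ^ 2 ≤ (α * β - 1) * (α' * β' - 1)) :
    (q + q⁻¹) / 2 ≤ (α * β' + β * α') / 2 - g := by
  have hq0 : 0 < q := by linarith
  have hq2 : 1 ≤ q ^ 2 := one_le_pow₀ hq
  obtain ⟨A, hA⟩ : ∃ A, A = α * β' := ⟨_, rfl⟩
  obtain ⟨B, hB⟩ : ∃ B, B = β * α' := ⟨_, rfl⟩
  have pA : 0 < A := hA ▸ mul_pos pα pβ'
  have pB : 0 < B := hB ▸ mul_pos pβ pα'
  have hAB : q ^ 2 * A ≤ B := by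
    calc q ^ 2 * A = α * (q ^ 2 * β') := by rw [hA]; ring
      _ ≤ β * α' := mul_le_mul hαβ hαβ' (by positivity) pβ.le
      _ = B := hB.symm
  have hprod : A * B = (α * β) * (α' * β') := by rw [hA, hB]; ring
  -- With `X = αβ - 1` and `Y = α'β' - 1`, `AB = (1 + X)(1 + Y)`, and `|g| ≤ √(XY) ≤ (X + Y) / 2`.
  have hm : (1 + |g|) ^ 2 ≤ A * B := by
    have h1 : |g| ^ 2 = g ^ 2 := sq_abs g
    have h2 : 2 * |g| ≤ (α * β - 1) + (α' * β' - 1) := by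
      have h3 : |g| ^ 2 ≤ (((α * β - 1) + (α' * β' - 1)) / 2) ^ 2 := by
        rw [h1]
        linarith [sq_nonneg ((α * β - 1) - (α' * β' - 1))]
      have := le_of_sq_le_sq h3 (by linarith)
      linarith
    rw [hprod]
    linarith
  have hmain : (1 + |g|) * (q + q⁻¹) ≤ A + B := by
    have h4 : A * B * (q + q⁻¹) ^ 2 ≤ (A + B) ^ 2 := by
      have h5 : (A + B) ^ 2 - A * B * (q + q⁻¹) ^ 2 =
          (B - q ^ 2 * A) * (B - A / q ^ 2) := by field_simp; ring
      have h6 : A / q ^ 2 ≤ B := by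
        rw [div_le_iff₀ (by positivity)]
        have := mul_le_mul_of_nonneg_left hq2 pB.le
        have := mul_le_mul_of_nonneg_right hq2 pA.le
        linarith
      have := mul_nonneg (sub_nonneg.2 hAB) (sub_nonneg.2 h6)
      linarith
    have h3 : ((1 + |g|) * (q + q⁻¹)) ^ 2 ≤ (A + B) ^ 2 := by
      rw [mul_pow]
      refine le_trans ?_ h4
      gcongr
    exact le_of_sq_le_sq h3 (by positivity)
  have hqq : 2 ≤ q + q⁻¹ := by
    have h1 : q + q⁻¹ - 2 = (q - 1) ^ 2 / q := by field_simp; ring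
    have h2 : 0 ≤ (q - 1) ^ 2 / q := by positivity
    linarith
  have h7 : g ≤ |g| := le_abs_self g
  have h8 := mul_le_mul_of_nonneg_left hqq (abs_nonneg g)
  rw [← hA, ← hB]
  linarith

/-! ### Pairs of null vectors -/

/-- Two future null vectors, normalised so that the geodesic between their classes is
parametrised by `t ↦ e^t • p + e^{-t} • m`. -/
structure NullFrame (p m : Vec) : Prop where
  pp : mink p p = 0
  mm : mink m m = 0
  pm : mink p m = -1 / 2
  p_future : 0 < p 0
  m_future : 0 < m 0

namespace NullFrame

variable {p m : Vec}

theorem mp (F : NullFrame p m) : mink m p = -1 / 2 := by rw [mink_comm, F.pm]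

/-- This frame runs along the same geodesic backwards, with its base at parameter `log q`.
Statements about the first vertex of an edge thereby serve for the second. -/
theorem smul (F : NullFrame p m) {q : ℝ} (hq : 0 < q) : NullFrame (q⁻¹ • m) (q • p) where
  pp := by simp [mink_smul_left, mink_smul_right, F.mm]
  mm := by simp [mink_smul_left, mink_smul_right, F.pp]
  pm := by
    rw [mink_smul_left, mink_smul_right, F.mp]; field_simp
  p_future := by
    have := F.m_future
    simp only [Pi.smul_apply, smul_eq_mul]; positivity
  m_future := by
    have := F.p_future
    simp only [Pi.smul_apply, smul_eq_mul]; positivity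

theorem mink_p_neg (F : NullFrame p m) {x : Vec} (hx : x ∈ hypPlane) : mink x p < 0 :=
  mink_neg_of_future (by rw [hx.1]; norm_num) hx.2 F.pp.le F.p_future

theorem mink_m_neg (F : NullFrame p m) {x : Vec} (hx : x ∈ hypPlane) : mink x m < 0 :=
  mink_neg_of_future (by rw [hx.1]; norm_num) hx.2 F.mm.le F.m_future

theorem mem_hypPlane (F : NullFrame p m) {a b : ℝ} (ha : 0 < a) (hab : a * b = 1) :
    a • p + b • m ∈ hypPlane := by
  have hb : 0 < b := by
    by_contra hn
    nlinarith
  refine ⟨?_, ?_⟩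
  · simp only [mink_add_left, mink_add_right, mink_smul_left, mink_smul_right, F.pp, F.mm,
      F.pm, F.mp]
    linear_combination -hab
  · have := F.p_future
    have := F.m_future
    simp only [Pi.add_apply, Pi.smul_apply, smul_eq_mul]; positivity

/-- Two half planes bounded by perpendiculars of a geodesic at distance `log q` have that
distance. -/
theorem mink_le (F : NullFrame p m) {x y : Vec} (hx : x ∈ hypPlane) (hy : y ∈ hypPlane) {q : ℝ}
    (hq : 1 ≤ q) (hxF : mink x p ≤ mink x m) (hyF : mink y m ≤ q ^ 2 * mink y p) :
    mink x y ≤ -((q + q⁻¹) / 2) := by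
  obtain ⟨α, hα⟩ : ∃ α, α = -2 * mink x m := ⟨_, rfl⟩
  obtain ⟨β, hβ⟩ : ∃ β, β = -2 * mink x p := ⟨_, rfl⟩
  obtain ⟨α', hα'⟩ : ∃ α', α' = -2 * mink y m := ⟨_, rfl⟩
  obtain ⟨β', hβ'⟩ : ∃ β', β' = -2 * mink y p := ⟨_, rfl⟩
  have pα : 0 < α := by linarith [F.mink_m_neg hx]
  have pβ : 0 < β := by linarith [F.mink_p_neg hx]
  have pα' : 0 < α' := by linarith [F.mink_m_neg hy]
  have pβ' : 0 < β' := by linarith [F.mink_p_neg hy]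
  have hxm : mink x m = -α / 2 := by linarith
  have hxp : mink x p = -β / 2 := by linarith
  have hym : mink y m = -α' / 2 := by linarith
  have hyp : mink y p = -β' / 2 := by linarith
  have hpp : mink (p + m) (p + m) = -1 := by
    simp only [mink_add_left, mink_add_right, F.pp, F.mm, F.pm, F.mp]; norm_num
  have hneg : mink (p + m) (p + m) < 0 := by rw [hpp]; norm_num
  -- Splitting off the null coordinates leaves vectors orthogonal to the plane of the frame, where
  -- the form is positive.
  set z := x - α • p - β • m with hz
  set w := y - α' • p - β' • m with hw
  have oz : mink z (p + m) = 0 := by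
    simp only [hz, mink_sub_left, mink_add_right, mink_smul_left, F.pp, F.mm, F.pm, F.mp, hxm, hxp]
    ring
  have ow : mink w (p + m) = 0 := by
    simp only [hw, mink_sub_left, mink_add_right, mink_smul_left, F.pp, F.mm, F.pm, F.mp, hym, hyp]
    ring
  have ezz : mink z z = α * β - 1 := by
    simp only [hz, mink_sub_left, mink_sub_right, mink_smul_left, mink_smul_right, F.pp, F.mm,
      F.pm, F.mp, hxm, hxp, mink_comm p x, mink_comm m x, hx.1]
    ring
  have eww : mink w w = α' * β' - 1 := by
    simp only [hw, mink_sub_left, mink_sub_right, mink_smul_left, mink_smul_right, F.pp, F.mm,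
      F.pm, F.mp, hym, hyp, mink_comm p y, mink_comm m y, hy.1]
    ring
  have ezw : mink z w = mink x y + (α * β' + β * α') / 2 := by
    simp only [hz, hw, mink_sub_left, mink_sub_right, mink_smul_left, mink_smul_right, F.pp, F.mm,
      F.pm, F.mp, hxm, hxp, mink_comm p y, mink_comm m y, hym, hyp]
    ring
  have hcs := mink_sq_le_of_orthogonal hneg oz ow
  have hzz := mink_self_nonneg_of_orthogonal hneg oz
  have hww := mink_self_nonneg_of_orthogonal hneg ow
  rw [ezz] at hzz hcs
  rw [eww] at hww hcs
  have := le_half_plane_product pα pβ pα' pβ' hq (by linarith)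
    (by rw [hα', hβ']; linarith) hzz hww hcs
  linarith

end NullFrame

namespace GenTriangle

variable (T : GenTriangle)

/-! ### Normalised vertices -/

/-- The factor that normalises the vertex `v i`. -/
def scale (i : Fin 3) : ℝ :=
  if mink (T.v i) (T.v i) < 0 then Real.sqrt (-mink (T.v i) (T.v i))
  else if mink (T.v i) (T.v i) = 0 then 2 * T.horo i
  else Real.sqrt (mink (T.v i) (T.v i))

/-- The normalised vertex: a unit vector, or the null vector `u` such that the horodisc is
`-⟨x, u⟩ ≤ 1 / 2`. -/
def unit (i : Fin 3) : Vec := (T.scale i)⁻¹ • T.v i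

theorem type_cases (i : Fin 3) : T.type i = 1 ∨ T.type i = 0 ∨ T.type i = -1 := by
  unfold type; split_ifs <;> simp

variable {T} {i : Fin 3}

theorem type_eq_one_iff : T.type i = 1 ↔ mink (T.v i) (T.v i) < 0 := by
  unfold type; split_ifs with h1 h2 <;> norm_num [h1]

theorem type_eq_zero_iff : T.type i = 0 ↔ mink (T.v i) (T.v i) = 0 := by
  unfold type; split_ifs with h1 h2
  · norm_num; exact h1.ne
  · norm_num [h2]
  · norm_num [h2]

theorem type_eq_neg_one_iff : T.type i = -1 ↔ 0 < mink (T.v i) (T.v i) := by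
  unfold type; split_ifs with h1 h2
  · norm_num; exact h1.le
  · norm_num [h2]
  · simp only [true_iff]; exact lt_of_le_of_ne (not_lt.1 h1) (Ne.symm h2)

theorem scale_of_type_one (h : T.type i = 1) : T.scale i = Real.sqrt (-mink (T.v i) (T.v i)) := by
  rw [scale, if_pos (type_eq_one_iff.1 h)]

theorem scale_of_type_zero (h : T.type i = 0) : T.scale i = 2 * T.horo i := by
  have := type_eq_zero_iff.1 h
  rw [scale, if_neg (by rw [this]; exact lt_irrefl _), if_pos this]

theorem scale_of_type_neg_one (h : T.type i = -1) :
    T.scale i = Real.sqrt (mink (T.v i) (T.v i)) := by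
  have := type_eq_neg_one_iff.1 h
  rw [scale, if_neg this.not_gt, if_neg this.ne']

variable (T i) in
theorem scale_pos : 0 < T.scale i := by
  rcases T.type_cases i with h | h | h
  · rw [scale_of_type_one h]
    exact Real.sqrt_pos.2 (by linarith [type_eq_one_iff.1 h])
  · rw [scale_of_type_zero h]
    linarith [T.horo_pos i (type_eq_zero_iff.1 h)]
  · rw [scale_of_type_neg_one h]
    exact Real.sqrt_pos.2 (type_eq_neg_one_iff.1 h)

variable (T i) in
theorem v_eq : T.v i = T.scale i • T.unit i := by
  rw [unit, smul_smul, mul_inv_cancel₀ (T.scale_pos i).ne', one_smul]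

variable (T i) in
theorem mink_unit_self : mink (T.unit i) (T.unit i) = -T.type i := by
  have hs := T.scale_pos i
  rw [unit, mink_smul_left, mink_smul_right]
  rcases T.type_cases i with h | h | h
  · have h1 := type_eq_one_iff.1 h
    have h2 : T.scale i ^ 2 = -mink (T.v i) (T.v i) := by
      rw [scale_of_type_one h, Real.sq_sqrt (by linarith)]
    rw [h]; field_simp; linarith
  · rw [h, type_eq_zero_iff.1 h]; simp
  · have h1 := type_eq_neg_one_iff.1 h
    have h2 : T.scale i ^ 2 = mink (T.v i) (T.v i) := by
      rw [scale_of_type_neg_one h, Real.sq_sqrt h1.le]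
    rw [h]; field_simp; linarith

theorem unit_future (h : 0 ≤ T.type i) : 0 < T.unit i 0 := by
  have : mink (T.v i) (T.v i) ≤ 0 := by
    by_contra hn
    rw [type_eq_neg_one_iff.2 (not_le.1 hn)] at h
    norm_num at h
  have h1 := T.future i this
  have h2 := T.scale_pos i
  simp only [unit, Pi.smul_apply, smul_eq_mul]; positivity

theorem toHyp_v (h : T.type i = 1) : toHyp (T.v i) = T.unit i := by
  rw [toHyp, unit, scale_of_type_one h]

theorem mink_unit_right (x : Vec) : mink x (T.v i) = T.scale i * mink x (T.unit i) := by
  rw [v_eq T i, mink_smul_right]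

theorem body_of_type_one (h : T.type i = 1) : T.body i = {T.unit i} := by
  rw [body, if_pos (type_eq_one_iff.1 h), toHyp_v h]

theorem bodyBoundary_of_type_one (h : T.type i = 1) : T.bodyBoundary i = {T.unit i} := by
  rw [bodyBoundary, if_pos (type_eq_one_iff.1 h), toHyp_v h]

theorem body_of_type_zero (h : T.type i = 0) :
    T.body i = {x | x ∈ hypPlane ∧ -mink x (T.unit i) ≤ 1 / 2} := by
  have h0 := type_eq_zero_iff.1 h
  have hp := T.horo_pos i h0
  rw [body, if_neg (by rw [h0]; exact lt_irrefl _), if_pos h0]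
  ext x
  refine and_congr_right fun _ => ?_
  rw [mink_unit_right, scale_of_type_zero h]
  constructor <;> intro h1 <;> nlinarith

theorem bodyBoundary_of_type_zero (h : T.type i = 0) :
    T.bodyBoundary i = {x | x ∈ hypPlane ∧ -mink x (T.unit i) = 1 / 2} := by
  have h0 := type_eq_zero_iff.1 h
  have hp := T.horo_pos i h0
  rw [bodyBoundary, if_neg (by rw [h0]; exact lt_irrefl _), if_pos h0]
  ext x
  refine and_congr_right fun _ => ?_
  rw [mink_unit_right, scale_of_type_zero h]
  constructor <;> intro h1 <;> nlinarith

theorem body_of_type_neg_one (h : T.type i = -1) :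
    T.body i = {x | x ∈ hypPlane ∧ 0 ≤ mink x (T.unit i)} := by
  have h0 := type_eq_neg_one_iff.1 h
  rw [body, if_neg h0.not_gt, if_neg h0.ne']
  ext x
  refine and_congr_right fun _ => ?_
  rw [mink_unit_right, mul_nonneg_iff_of_pos_left (T.scale_pos i)]

theorem bodyBoundary_of_type_neg_one (h : T.type i = -1) :
    T.bodyBoundary i = {x | x ∈ hypPlane ∧ mink x (T.unit i) = 0} := by
  have h0 := type_eq_neg_one_iff.1 h
  rw [bodyBoundary, if_neg h0.not_gt, if_neg h0.ne']
  ext x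
  refine and_congr_right fun _ => ?_
  rw [mink_unit_right, mul_eq_zero_iff_left (ne_of_gt (T.scale_pos i))]

/-! ### The bodies in a null frame -/

variable {p m : Vec}

theorem frame_base_mem_hypPlane (F : NullFrame p m) : p + m ∈ hypPlane := by
  simpa using F.mem_hypPlane one_pos (one_mul 1)

theorem frame_base_mem_bodyBoundary (F : NullFrame p m) (hu : T.unit i = m + T.type i • p) :
    p + m ∈ T.bodyBoundary i := by
  rcases T.type_cases i with h | h | h
  · rw [bodyBoundary_of_type_one h, hu, h, one_smul, add_comm]; rfl
  · rw [bodyBoundary_of_type_zero h, hu, h]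
    refine ⟨frame_base_mem_hypPlane F, ?_⟩
    simp only [mink_add_left, mink_add_right, mink_smul_right, F.pm, F.mm]; norm_num
  · rw [bodyBoundary_of_type_neg_one h, hu, h]
    refine ⟨frame_base_mem_hypPlane F, ?_⟩
    simp only [mink_add_left, mink_add_right, mink_smul_right, F.pp, F.pm, F.mp, F.mm]; norm_num

variable (T i) in
theorem bodyBoundary_subset_body : T.bodyBoundary i ⊆ T.body i := by
  rcases T.type_cases i with h | h | h
  · rw [bodyBoundary_of_type_one h, body_of_type_one h]
  · rw [bodyBoundary_of_type_zero h, body_of_type_zero h]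
    exact fun x hx => ⟨hx.1, hx.2.le⟩
  · rw [bodyBoundary_of_type_neg_one h, body_of_type_neg_one h]
    exact fun x hx => ⟨hx.1, hx.2.ge⟩

/-- Each body lies in the half plane whose boundary passes through the base of the frame. -/
theorem body_le_of_frame (F : NullFrame p m) (hu : T.unit i = m + T.type i • p) {x : Vec}
    (hx : x ∈ T.body i) : x ∈ hypPlane ∧ mink x p ≤ mink x m := by
  rcases T.type_cases i with h | h | h
  · rw [body_of_type_one h, hu, h, one_smul, add_comm] at hx
    obtain rfl := hx
    refine ⟨frame_base_mem_hypPlane F, ?_⟩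
    simp only [mink_add_left, F.pp, F.pm, F.mp, F.mm]; norm_num
  · rw [body_of_type_zero h, hu, h, zero_smul, add_zero] at hx
    obtain ⟨hx, h1⟩ := hx
    refine ⟨hx, ?_⟩
    -- The null coordinates `α = -2⟨x, m⟩`, `β = -2⟨x, p⟩` of a point of `ℍ²` satisfy `αβ ≥ 1`. The
    -- horodisc is `α ≤ 1`, hence `β ≥ 1 ≥ α`.
    have hz := mink_self_nonneg_of_orthogonal (p := p + m)
      (z := x - (-2 * mink x m) • p - (-2 * mink x p) • m)
      (by rw [(frame_base_mem_hypPlane F).1]; norm_num)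
      (by
        simp only [mink_sub_left, mink_add_right, mink_smul_left, F.pp, F.mm, F.pm, F.mp]
        ring)
    simp only [mink_sub_left, mink_sub_right, mink_smul_left, mink_smul_right, F.pp, F.mm,
      F.pm, F.mp, mink_comm p x, mink_comm m x, hx.1] at hz
    have hp := F.mink_p_neg hx
    have hm := F.mink_m_neg hx
    nlinarith
  · rw [body_of_type_neg_one h, hu, h] at hx
    obtain ⟨hx, h1⟩ := hx
    rw [mink_add_right, mink_smul_right] at h1
    exact ⟨hx, by linarith⟩

theorem eq_base_of_mem_bodyBoundary (F : NullFrame p m) (hu : T.unit i = m + T.type i • p)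
    {a b : ℝ} (hx : a • p + b • m ∈ T.bodyBoundary i) : a • p + b • m = p + m := by
  rcases T.type_cases i with h | h | h
  · rw [bodyBoundary_of_type_one h, hu, h, one_smul, add_comm m p] at hx
    exact hx
  · rw [bodyBoundary_of_type_zero h, hu, h, zero_smul, add_zero] at hx
    obtain ⟨⟨h1, -⟩, h2⟩ := hx
    simp only [mink_add_left, mink_add_right, mink_smul_left, mink_smul_right, F.pp, F.mm,
      F.pm, F.mp] at h1 h2
    have ha : a = 1 := by linarith
    have hb : b = 1 := by rw [ha] at h1; linarith
    rw [ha, hb, one_smul, one_smul]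
  · rw [bodyBoundary_of_type_neg_one h, hu, h] at hx
    obtain ⟨hx, h2⟩ := hx
    have h1 := hx.1
    -- Needed to exclude `a = b = -1`, which the two equations allow.
    have h3 := F.mink_m_neg hx
    simp only [mink_add_left, mink_add_right, mink_smul_left, mink_smul_right, F.pp, F.mm,
      F.pm, F.mp] at h1 h2 h3
    have hab : a = b := by linarith
    have ha : a = 1 := by
      rw [← hab] at h1
      nlinarith
    rw [← hab, ha, one_smul, one_smul]

theorem mem_body_of_type_zero (F : NullFrame p m) (hu : T.unit i = m + T.type i • p)
    (h : T.type i = 0) {a b : ℝ} (ha : 0 < a) (hab : a * b = 1) (ha1 : a ≤ 1) :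
    a • p + b • m ∈ T.body i := by
  rw [body_of_type_zero h, hu, h, zero_smul, add_zero]
  refine ⟨F.mem_hypPlane ha hab, ?_⟩
  simp only [mink_add_left, mink_smul_left, F.mm, F.pm]
  linarith

end GenTriangle

namespace GenTriangle

variable (T : GenTriangle)

/-! ### The edges -/

theorem sum_rotate {M : Type*} [AddCommMonoid M] (f : Fin 3 → M) (i : Fin 3) :
    ∑ l, f l = f i + f (i + 1) + f (i + 2) := by
  rw [Fin.sum_univ_three]
  fin_cases i
  · rfl
  · change _ = f 1 + f 2 + f 0
    abel
  · change _ = f 2 + f 0 + f 1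
    abel

theorem unit_indep : LinearIndependent ℝ T.unit := by
  have := T.indep.units_smul fun i => Units.mk0 _ (inv_ne_zero (T.scale_pos i).ne')
  exact this

theorem eq_zero_of_comb (i : Fin 3) {a b c : ℝ}
    (h : a • T.unit i + b • T.unit (i + 1) + c • T.unit (i + 2) = 0) :
    a = 0 ∧ b = 0 ∧ c = 0 := by
  have e1 : i + 1 ≠ i := by clear h; revert i; decide
  have e2 : i + 2 ≠ i := by clear h; revert i; decide
  have e3 : i + 2 ≠ i + 1 := by clear h; revert i; decide
  have h1 := Fintype.linearIndependent_iff.1 T.unit_indep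
    (fun l => if l = i then a else if l = i + 1 then b else c) (by
      rw [sum_rotate _ i]
      simpa [e1, e2, e3] using h)
  have h2 := h1 i
  have h3 := h1 (i + 1)
  have h4 := h1 (i + 2)
  simp only [e1, e2, e3, if_true, if_false] at h2 h3 h4
  exact ⟨h2, h3, h4⟩

theorem exists_comb_unit_iff (i : Fin 3) (x : Vec) :
    (∃ a b : ℝ, x = a • T.v (i + 1) + b • T.v (i + 2)) ↔
      ∃ a b : ℝ, x = a • T.unit (i + 1) + b • T.unit (i + 2) := by
  have h1 := (T.scale_pos (i + 1)).ne'
  have h2 := (T.scale_pos (i + 2)).ne'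
  constructor
  · rintro ⟨a, b, rfl⟩
    exact ⟨a * T.scale (i + 1), b * T.scale (i + 2), by rw [v_eq, v_eq, smul_smul, smul_smul]⟩
  · rintro ⟨a, b, rfl⟩
    exact ⟨a * (T.scale (i + 1))⁻¹, b * (T.scale (i + 2))⁻¹, by
      rw [unit, unit, smul_smul, smul_smul]⟩

theorem mem_sideLine_iff (i : Fin 3) (x : Vec) :
    x ∈ sideLine T.v i ↔
      x ∈ hypPlane ∧ ∃ a b : ℝ, x = a • T.unit (i + 1) + b • T.unit (i + 2) := by
  rw [← exists_comb_unit_iff]; rfl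

/-- The polygon supplies nonnegative coefficients in three vectors, the side line two of unknown
sign; independence identifies them. -/
theorem edge_point {i : Fin 3} {x : Vec} (hx : x ∈ sideLine T.v i ∩ polygon T.v) :
    ∃ a b : ℝ, 0 ≤ a ∧ 0 ≤ b ∧ x = a • T.unit (i + 1) + b • T.unit (i + 2) := by
  obtain ⟨h1, -, ⟨a, ha, h2⟩, -⟩ := hx
  obtain ⟨-, a', b', h3⟩ := (T.mem_sideLine_iff i x).1 h1
  rw [sum_rotate _ i, T.v_eq i, T.v_eq (i + 1), T.v_eq (i + 2), smul_smul, smul_smul,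
    smul_smul] at h2
  have h4 := T.eq_zero_of_comb i (a := a i * T.scale i) (b := a (i + 1) * T.scale (i + 1) - a')
    (c := a (i + 2) * T.scale (i + 2) - b') (by
      rw [sub_smul, sub_smul]
      have h5 := h2.symm.trans h3
      rw [← sub_eq_zero] at h5
      rw [← h5]; abel)
  refine ⟨a', b', ?_, ?_, h3⟩
  · linarith [h4.2.1, mul_nonneg (ha (i + 1)) (T.scale_pos (i + 1)).le]
  · linarith [h4.2.2, mul_nonneg (ha (i + 2)) (T.scale_pos (i + 2)).le]

theorem mink_unit_nonpos {l : Fin 3} (h : T.type l = -1) {x : Vec} (hx : x ∈ polygon T.v) :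
    mink x (T.unit l) ≤ 0 := by
  have h1 := hx.2.2 l (type_eq_neg_one_iff.1 h)
  rw [mink_unit_right] at h1
  by_contra hn
  nlinarith [mul_pos (T.scale_pos l) (not_le.1 hn)]

theorem eq_of_smul_mem_hypPlane {w : Vec} {a b : ℝ} (ha : 0 ≤ a) (hb : 0 ≤ b)
    (h1 : a • w ∈ hypPlane) (h2 : b • w ∈ hypPlane) : a • w = b • w := by
  have h3 := h1.1
  have h4 := h2.1
  rw [mink_smul_left, mink_smul_right] at h3 h4
  have h5 : mink w w ≠ 0 := by rintro h0; rw [h0] at h3; norm_num at h3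
  have h6 : a ^ 2 = b ^ 2 := mul_right_cancel₀ h5 (by linarith)
  rw [(sq_eq_sq₀ ha hb).1 h6]

/-- If the coefficient vanished at two distinct points of the edge, both would lie in `ℍ²` on the
ray of the other vertex, and a ray meets the hyperboloid only once. -/
theorem exists_edge_point_left (i : Fin 3) :
    ∃ a b : ℝ, 0 < a ∧ 0 ≤ b ∧ a • T.unit (i + 1) + b • T.unit (i + 2) ∈ polygon T.v := by
  obtain ⟨x, hx, y, hy, hxy⟩ := T.edge_nontrivial i
  obtain ⟨a, b, ha, hb, h1⟩ := T.edge_point hx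
  obtain ⟨a', b', ha', hb', h2⟩ := T.edge_point hy
  rcases ha.lt_or_eq with h | h
  · exact ⟨a, b, h, hb, h1 ▸ hx.2⟩
  rcases ha'.lt_or_eq with h' | h'
  · exact ⟨a', b', h', hb', h2 ▸ hy.2⟩
  rw [← h, zero_smul, zero_add] at h1
  rw [← h', zero_smul, zero_add] at h2
  exact absurd (h1.trans ((eq_of_smul_mem_hypPlane hb hb' (h1 ▸ hx.1.1) (h2 ▸ hy.1.1)).trans
    h2.symm)) hxy

theorem exists_edge_point_right (i : Fin 3) :
    ∃ a b : ℝ, 0 ≤ a ∧ 0 < b ∧ a • T.unit (i + 1) + b • T.unit (i + 2) ∈ polygon T.v := by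
  obtain ⟨x, hx, y, hy, hxy⟩ := T.edge_nontrivial i
  obtain ⟨a, b, ha, hb, h1⟩ := T.edge_point hx
  obtain ⟨a', b', ha', hb', h2⟩ := T.edge_point hy
  rcases hb.lt_or_eq with h | h
  · exact ⟨a, b, ha, h, h1 ▸ hx.2⟩
  rcases hb'.lt_or_eq with h' | h'
  · exact ⟨a', b', ha', h', h2 ▸ hy.2⟩
  rw [← h, zero_smul, add_zero] at h1
  rw [← h', zero_smul, add_zero] at h2
  exact absurd (h1.trans ((eq_of_smul_mem_hypPlane ha ha' (h1 ▸ hx.1.1) (h2 ▸ hy.1.1)).trans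
    h2.symm)) hxy

/-! ### The Gram matrix -/

/-- The off-diagonal entries of the negative of the Gram matrix of the normalised vertices. -/
def gram (i : Fin 3) : ℝ := -mink (T.unit (i + 1)) (T.unit (i + 2))

theorem mink_unit_unit (i : Fin 3) : mink (T.unit (i + 1)) (T.unit (i + 2)) = -T.gram i := by
  rw [gram, neg_neg]

theorem mink_unit_unit' (i : Fin 3) : mink (T.unit (i + 2)) (T.unit (i + 1)) = -T.gram i := by
  rw [mink_comm, mink_unit_unit]

/-- At a vertex `u` of type `-1`, an edge point `x = a u + b w` with `a > 0` satisfies `⟨x, u⟩ = a -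
b c ≤ 0`, which forces `c > 0`. Otherwise both vertices are future: if one is timelike, their
product is negative; if both are null, `⟨x, x⟩ = -2abc = -1`. -/
theorem gram_pos (i : Fin 3) : 0 < T.gram i := by
  obtain ⟨a, b, ha, hb, h⟩ := T.exists_edge_point_left i
  obtain ⟨a', b', ha', hb', h'⟩ := T.exists_edge_point_right i
  have s1 := T.mink_unit_self (i + 1)
  have s2 := T.mink_unit_self (i + 2)
  have hg := T.mink_unit_unit i
  have hg' := T.mink_unit_unit' i
  by_contra hn
  rw [not_lt] at hn
  by_cases n1 : T.type (i + 1) = -1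
  · have h1 := T.mink_unit_nonpos n1 h
    rw [mink_add_left, mink_smul_left, mink_smul_left, s1, n1, hg'] at h1
    nlinarith [mul_nonneg hb (neg_nonneg.2 hn)]
  by_cases n2 : T.type (i + 2) = -1
  · have h1 := T.mink_unit_nonpos n2 h'
    rw [mink_add_left, mink_smul_left, mink_smul_left, s2, n2, hg] at h1
    nlinarith [mul_nonneg ha' (neg_nonneg.2 hn)]
  have f1 : 0 ≤ T.type (i + 1) := by
    rcases T.type_cases (i + 1) with h | h | h
    · rw [h]; norm_num
    · rw [h]
    · exact absurd h n1
  have f2 : 0 ≤ T.type (i + 2) := by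
    rcases T.type_cases (i + 2) with h | h | h
    · rw [h]; norm_num
    · rw [h]
    · exact absurd h n2
  rcases f1.lt_or_eq with p1 | p1
  · have := mink_neg_of_future (by rw [s1]; linarith) (unit_future f1)
      (by rw [s2]; linarith) (unit_future f2)
    rw [hg] at this
    linarith
  rcases f2.lt_or_eq with p2 | p2
  · have := mink_neg_of_future (by rw [s2]; linarith) (unit_future f2)
      (by rw [s1]; linarith) (unit_future f1)
    rw [hg'] at this
    linarith
  have h1 := h.1.1
  simp only [mink_add_left, mink_add_right, mink_smul_left, mink_smul_right, s1, s2, hg, hg',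
    ← p1, ← p2] at h1
  nlinarith [mul_nonneg (mul_nonneg ha.le hb) (neg_nonneg.2 hn)]

/-- Only equal nonzero types need an argument. For two points it is strict reversed Cauchy-Schwarz,
from independence. For two outer vertices, an edge point gives `a² + b² - 2abc = -1`, which is
impossible if `c ≤ 1`. -/
theorem gram_sq_sub_pos (i : Fin 3) :
    0 < T.gram i ^ 2 - T.type (i + 1) * T.type (i + 2) := by
  have hc := T.gram_pos i
  have hc2 : 0 < T.gram i ^ 2 := by positivity
  have s1 := T.mink_unit_self (i + 1)
  have s2 := T.mink_unit_self (i + 2)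
  have hg := T.mink_unit_unit i
  have hg' := T.mink_unit_unit' i
  rcases T.type_cases (i + 1) with h1 | h1 | h1 <;>
  rcases T.type_cases (i + 2) with h2 | h2 | h2 <;> rw [h1] at s1 <;> rw [h2] at s2 <;>
    rw [h1, h2] <;> try linarith
  · have := mink_self_pos_of_orthogonal (p := T.unit (i + 1))
      (z := T.unit (i + 2) - T.gram i • T.unit (i + 1)) (by rw [s1]; norm_num)
      (by rw [mink_sub_left, mink_smul_left, s1, hg']; ring)
      (by
        intro h0
        have := T.eq_zero_of_comb i (a := 0) (b := -T.gram i) (c := 1)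
          (by rw [← h0, neg_smul]; simp; abel)
        linarith [this.2.2])
    simp only [mink_sub_left, mink_sub_right, mink_smul_left, mink_smul_right, s1, s2, hg,
      hg'] at this
    linarith
  · obtain ⟨a, b, ha, hb, h⟩ := T.exists_edge_point_left i
    have h3 := h.1.1
    simp only [mink_add_left, mink_add_right, mink_smul_left, mink_smul_right, s1, s2, hg,
      hg'] at h3
    have h4 : 1 < T.gram i := by
      by_contra hn
      nlinarith [mul_nonneg (mul_nonneg ha.le hb) (sub_nonneg.2 (not_lt.1 hn)),
        sq_nonneg (a - b)]
    nlinarith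

/-- The determinant of the negative of the Gram matrix. -/
def gramDet : ℝ :=
  T.type 0 * T.type 1 * T.type 2 + 2 * T.gram 0 * T.gram 1 * T.gram 2
    - T.type 0 * T.gram 0 ^ 2 - T.type 1 * T.gram 1 ^ 2 - T.type 2 * T.gram 2 ^ 2

theorem gramDet_pos : 0 < T.gramDet := by
  have h : IsUnit (Matrix.of T.unit) :=
    Matrix.linearIndependent_rows_iff_isUnit.1 T.unit_indep
  have hdet : (Matrix.of T.unit).det ≠ 0 := ((Matrix.isUnit_iff_isUnit_det _).1 h).ne_zero
  have ht (i : Fin 3) : T.type i = -mink (T.unit i) (T.unit i) := by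
    rw [mink_unit_self, neg_neg]
  have g0 : T.gram 0 = -mink (T.unit 1) (T.unit 2) := rfl
  have g1 : T.gram 1 = -mink (T.unit 2) (T.unit 0) := rfl
  have g2 : T.gram 2 = -mink (T.unit 0) (T.unit 1) := rfl
  -- The Gram matrix is `U J Uᵀ` with `det J = -1`, and negating a `3 × 3` matrix changes the sign
  -- once more.
  have : T.gramDet = (Matrix.of T.unit).det ^ 2 := by
    rw [gramDet, ht, ht, ht, g0, g1, g2, Matrix.det_fin_three]
    simp only [mink, Matrix.of_apply]
    ring
  rw [this]
  positivity

theorem gramDet_rotate (i : Fin 3) : T.gramDet =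
    T.type i * T.type (i + 1) * T.type (i + 2) + 2 * T.gram i * T.gram (i + 1) * T.gram (i + 2)
    - T.type i * T.gram i ^ 2 - T.type (i + 1) * T.gram (i + 1) ^ 2
    - T.type (i + 2) * T.gram (i + 2) ^ 2 := by
  fin_cases i
  · rfl
  · change _ = T.type 1 * T.type 2 * T.type 0 + 2 * T.gram 1 * T.gram 2 * T.gram 0
      - T.type 1 * T.gram 1 ^ 2 - T.type 2 * T.gram 2 ^ 2 - T.type 0 * T.gram 0 ^ 2
    rw [gramDet]; ring
  · change _ = T.type 2 * T.type 0 * T.type 1 + 2 * T.gram 2 * T.gram 0 * T.gram 1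
      - T.type 2 * T.gram 2 ^ 2 - T.type 0 * T.gram 0 ^ 2 - T.type 1 * T.gram 1 ^ 2
    rw [gramDet]; ring

/-- The square root of a principal minor of the Gram matrix. -/
def minor (i : Fin 3) : ℝ := Real.sqrt (T.gram i ^ 2 - T.type (i + 1) * T.type (i + 2))

theorem minor_pos (i : Fin 3) : 0 < T.minor i := Real.sqrt_pos.2 (T.gram_sq_sub_pos i)

theorem minor_sq (i : Fin 3) :
    T.minor i ^ 2 = T.gram i ^ 2 - T.type (i + 1) * T.type (i + 2) :=
  Real.sq_sqrt (T.gram_sq_sub_pos i).le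

end GenTriangle

namespace GenTriangle

variable (T : GenTriangle)

/-! ### The edge lengths -/

/-- The exponential of the generalized length. -/
def expLength (i : Fin 3) : ℝ := T.gram i + T.minor i

theorem expLength_pos (i : Fin 3) : 0 < T.expLength i :=
  add_pos (T.gram_pos i) (T.minor_pos i)

theorem expLength_add (i : Fin 3) :
    T.expLength i + T.type (i + 1) * T.type (i + 2) * (T.expLength i)⁻¹ = 2 * T.gram i := by
  have h := T.minor_sq i
  have hq := (T.expLength_pos i).ne'
  field_simp
  rw [expLength]
  linear_combination h

theorem expLength_sub (i : Fin 3) :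
    T.expLength i - T.type (i + 1) * T.type (i + 2) * (T.expLength i)⁻¹ = 2 * T.minor i := by
  have h := T.expLength_add i
  rw [expLength] at *
  linarith

theorem one_lt_expLength {i : Fin 3} (h1 : T.type (i + 1) ≠ 0) (h2 : T.type (i + 2) ≠ 0) :
    1 < T.expLength i := by
  have hc := T.gram_pos i
  have ht := T.minor_pos i
  have hs := T.minor_sq i
  have h3 : T.type (i + 1) * T.type (i + 2) = 1 ∨ T.type (i + 1) * T.type (i + 2) = -1 := by
    rcases T.type_cases (i + 1) with h | h | h
    · rcases T.type_cases (i + 2) with h' | h' | h'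
      · simp [h, h']
      · exact absurd h' h2
      · simp [h, h']
    · exact absurd h h1
    · rcases T.type_cases (i + 2) with h' | h' | h'
      · simp [h, h']
      · exact absurd h' h2
      · simp [h, h']
  rw [expLength]
  rcases h3 with h3 | h3
  · rw [h3] at hs
    nlinarith
  · rw [h3] at hs
    nlinarith

/-- The two quantities are the null coordinates of an edge point, so that `p` and `m` come out
future. Their product is `1`, so they have the same sign. Both negative would need `e = f = -1` with
`q b < a < r b`, contradicting `r < q`. -/
theorem frame_coeff_pos {e f q r a b : ℝ} (he : e = 1 ∨ e = 0 ∨ e = -1)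
    (hf : f = 1 ∨ f = 0 ∨ f = -1) (hbig : e ≠ 0 → f ≠ 0 → 1 < q) (hq : 0 < q) (hr : 0 < r)
    (hqr : q * r = 1) (ha : 0 ≤ a) (hb : 0 ≤ b) (h : (a + f * r * b) * (e * a + q * b) = 1) :
    0 < e * a + q * b ∧ 0 < a + f * r * b := by
  have hqb := mul_nonneg hq.le hb
  have hrb := mul_nonneg hr.le hb
  have hα : 0 < e * a + q * b := by
    by_contra hn
    have h3 : e * a + q * b < 0 := by
      refine lt_of_le_of_ne (not_lt.1 hn) ?_
      rintro h0
      rw [h0] at h; norm_num at h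
    have h2 : a + f * r * b < 0 := by
      by_contra hn'
      have := mul_nonpos_of_nonneg_of_nonpos (not_lt.1 hn') h3.le
      linarith
    have he : e = -1 := by
      rcases he with h | h | h
      · rw [h] at h3; linarith
      · rw [h] at h3; linarith
      · exact h
    have hf : f = -1 := by
      rcases hf with h | h | h
      · rw [h] at h2; linarith
      · rw [h] at h2; linarith
      · exact h
    have hq1 := hbig (by rw [he]; norm_num) (by rw [hf]; norm_num)
    have hr1 : r < q := by
      have : r * 1 < r * q := mul_lt_mul_of_pos_left hq1 hr
      linarith
    rw [he] at h3
    rw [hf] at h2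
    have := mul_nonneg hb (sub_nonneg.2 hr1.le)
    linarith
  refine ⟨hα, ?_⟩
  by_contra hn
  have := mul_nonpos_of_nonpos_of_nonneg (not_lt.1 hn) hα.le
  linarith

/-- The two vertices of an edge in a null frame. -/
theorem exists_nullFrame (i : Fin 3) : ∃ p m : Vec, NullFrame p m ∧
    T.unit (i + 1) = m + T.type (i + 1) • p ∧
    T.unit (i + 2) = T.expLength i • p + T.type (i + 2) • (T.expLength i)⁻¹ • m := by
  have ht := T.minor_pos i
  have hq := T.expLength_pos i
  have hadd := T.expLength_add i
  have hsub := T.expLength_sub i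
  have s1 := T.mink_unit_self (i + 1)
  have s2 := T.mink_unit_self (i + 2)
  have hg := T.mink_unit_unit i
  have hg' := T.mink_unit_unit' i
  have hbig := T.one_lt_expLength (i := i)
  have htc1 := T.type_cases (i + 1)
  have htc2 := T.type_cases (i + 2)
  obtain ⟨a, b, ha, hb, hx⟩ := T.exists_edge_point_left i
  replace hx := hx.1
  generalize T.unit (i + 1) = u at *
  generalize T.unit (i + 2) = w at *
  generalize T.type (i + 1) = e at *
  generalize T.type (i + 2) = f at *
  generalize T.gram i = c at *
  generalize T.minor i = t at *
  generalize T.expLength i = q at *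
  obtain ⟨r, hr⟩ : ∃ r, r = q⁻¹ := ⟨_, rfl⟩
  have hqr : q * r = 1 := by rw [hr]; exact mul_inv_cancel₀ hq.ne'
  have hr0 : 0 < r := by rw [hr]; positivity
  rw [← hr] at hadd hsub ⊢
  obtain ⟨k, hk⟩ : ∃ k, k = (2 * t)⁻¹ := ⟨_, rfl⟩
  have hkt : k * (q - e * f * r) = 1 := by
    rw [hk, hsub]; exact inv_mul_cancel₀ (by positivity)
  have hc : c = (q + e * f * r) / 2 := by linarith
  -- Solution of the linear system `u = m + e p`, `w = q p + f r m`, whose determinant `q - e f r`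
  -- is `2t`.
  obtain ⟨p, hp⟩ : ∃ p, p = k • (w - (f * r) • u) := ⟨_, rfl⟩
  obtain ⟨m, hm⟩ : ∃ m, m = k • (q • u - e • w) := ⟨_, rfl⟩
  have hpp : mink p p = 0 := by
    rw [hp]
    simp only [mink_sub_left, mink_sub_right, mink_smul_left, mink_smul_right, s1, s2, hg, hg', hc]
    linear_combination (k ^ 2 * f) * hqr
  have hmm : mink m m = 0 := by
    rw [hm]
    simp only [mink_sub_left, mink_sub_right, mink_smul_left, mink_smul_right, s1, s2, hg, hg', hc]
    linear_combination (k ^ 2 * e ^ 2 * f) * hqr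
  have hpm : mink p m = -1 / 2 := by
    rw [hp, hm]
    simp only [mink_sub_left, mink_sub_right, mink_smul_left, mink_smul_right, s1, s2, hg, hg', hc]
    linear_combination (-(k * (q - e * f * r)) / 2 - 1 / 2) * hkt - (k ^ 2 * e * f) * hqr
  have hu : u = m + e • p := by
    funext j
    simp only [hp, hm, Pi.add_apply, Pi.sub_apply, Pi.smul_apply, smul_eq_mul]
    linear_combination (-u j) * hkt
  have hw : w = q • p + f • r • m := by
    funext j
    simp only [hp, hm, Pi.add_apply, Pi.sub_apply, Pi.smul_apply, smul_eq_mul]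
    linear_combination (-w j) * hkt
  have hmp : mink m p = -1 / 2 := by rw [mink_comm, hpm]
  have hxp : mink (a • u + b • w) p = -(a + f * r * b) / 2 := by
    rw [hu, hw]
    simp only [mink_add_left, mink_smul_left, hpp, hmp]
    ring
  have hxm : mink (a • u + b • w) m = -(e * a + q * b) / 2 := by
    rw [hu, hw]
    simp only [mink_add_left, mink_smul_left, hmm, hpm]
    ring
  have hprod : (a + f * r * b) * (e * a + q * b) = 1 := by
    have h1 := hx.1
    have hx' : a • u + b • w = (e * a + q * b) • p + (a + f * r * b) • m := by
      rw [hu, hw]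
      funext j
      simp only [Pi.add_apply, Pi.smul_apply, smul_eq_mul]
      ring
    rw [hx'] at h1
    simp only [mink_add_left, mink_add_right, mink_smul_left, mink_smul_right, hpp, hmm, hpm,
      hmp] at h1
    linarith
  obtain ⟨hα, hβ⟩ := frame_coeff_pos htc1 htc2 hbig hq hr0 hqr ha.le hb hprod
  exact ⟨p, m, ⟨hpp, hmm, hpm, future_of_mink_neg hx hpp.le (by rw [hxp]; linarith),
    future_of_mink_neg hx hmm.le (by rw [hxm]; linarith)⟩, hu, hw⟩

/-- The perpendiculars at the two bases separate the bodies when `q > 1`. If `q ≤ 1`, the bodies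
meet, and their boundaries cut the geodesic exactly at the bases, `-log q` apart. -/
theorem length_eq (i : Fin 3) : T.length i = Real.log (T.expLength i) := by
  obtain ⟨p, m, F, hu, hw⟩ := T.exists_nullFrame i
  have hq := T.expLength_pos i
  have hbig := T.one_lt_expLength (i := i)
  obtain ⟨q, hqdef⟩ : ∃ q, q = T.expLength i := ⟨_, rfl⟩
  rw [← hqdef] at hw hq hbig ⊢
  have F' := F.smul hq
  have hw' : T.unit (i + 2) = q • p + T.type (i + 2) • (q⁻¹ • m) := hw
  set P := p + m with hP
  set Q := q⁻¹ • m + q • p with hQ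
  have hQ' : Q = q • p + q⁻¹ • m := add_comm _ _
  have hP' : P = q • (q⁻¹ • m) + q⁻¹ • (q • p) := by
    rw [smul_smul, smul_smul, mul_inv_cancel₀ hq.ne', inv_mul_cancel₀ hq.ne', one_smul, one_smul,
      add_comm]
  have hPh : P ∈ hypPlane := frame_base_mem_hypPlane F
  have hQh : Q ∈ hypPlane := frame_base_mem_hypPlane F'
  have hPb : P ∈ T.bodyBoundary (i + 1) := frame_base_mem_bodyBoundary F hu
  have hQb : Q ∈ T.bodyBoundary (i + 2) := frame_base_mem_bodyBoundary F' hw'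
  have hPQ : mink P Q = -((q + q⁻¹) / 2) := by
    rw [hP, hQ]
    simp only [mink_add_left, mink_add_right, mink_smul_right, F.pp, F.mm, F.pm, F.mp]
    ring
  have hcosh : Real.cosh (Real.log q) = (q + q⁻¹) / 2 := by
    rw [Real.cosh_eq, Real.exp_neg, Real.exp_log hq]
  have hPQ1 := mink_le_neg_one hPh hQh
  have hle : ∀ x ∈ T.body (i + 1), ∀ y ∈ T.body (i + 2), 1 ≤ q →
      mink x y ≤ -((q + q⁻¹) / 2) := by
    intro x hx y hy hq1
    obtain ⟨hxh, hx⟩ := body_le_of_frame F hu hx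
    obtain ⟨hyh, hy⟩ := body_le_of_frame F' hw' hy
    refine F.mink_le hxh hyh hq1 hx ?_
    rw [mink_smul_right, mink_smul_right, inv_mul_le_iff₀ hq] at hy
    linarith
  rw [length]
  rcases lt_or_ge 1 q with hq1 | hq1
  · have hempty : T.body (i + 1) ∩ T.body (i + 2) = ∅ := by
      rw [Set.eq_empty_iff_forall_notMem]
      rintro x ⟨hx1, hx2⟩
      -- A common point would be at distance at least `log q > 0` from itself.
      have h1 := hle x hx1 x hx2 hq1.le
      rw [(body_le_of_frame F hu hx1).1.1, ← hcosh] at h1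
      have := Real.one_lt_cosh.2 (Real.log_pos hq1).ne'
      linarith
    rw [if_pos hempty, setDist_eq (T.bodyBoundary_subset_body _ hPb)
      (T.bodyBoundary_subset_body _ hQb) hPQ1
      (fun x hx y hy => by rw [hPQ]; exact hle x hx y hy hq1.le), hPQ, neg_neg, ← hcosh,
      Real.arcosh_cosh (Real.log_nonneg hq1.le)]
  · have hne : ¬T.body (i + 1) ∩ T.body (i + 2) = ∅ := by
      rw [← ne_eq, ← Set.nonempty_iff_ne_empty]
      by_cases h1 : T.type (i + 1) = 0
      · refine ⟨Q, ?_, T.bodyBoundary_subset_body _ hQb⟩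
        rw [hQ']
        exact mem_body_of_type_zero F hu h1 hq (mul_inv_cancel₀ hq.ne') hq1
      by_cases h2 : T.type (i + 2) = 0
      · refine ⟨P, T.bodyBoundary_subset_body _ hPb, ?_⟩
        rw [hP']
        exact mem_body_of_type_zero F' hw' h2 hq (mul_inv_cancel₀ hq.ne') hq1
      exact absurd (hbig h1 h2) (not_lt.2 hq1)
    have hcomb (x : Vec) (hx : x ∈ sideLine T.v i) : ∃ a b : ℝ, x = a • p + b • m := by
      obtain ⟨-, a, b, rfl⟩ := (T.mem_sideLine_iff i x).1 hx
      refine ⟨a * T.type (i + 1) + b * q, a + b * T.type (i + 2) * q⁻¹, ?_⟩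
      rw [hu, hw]
      funext j
      simp only [Pi.add_apply, Pi.smul_apply, smul_eq_mul]
      ring
    have hu2 : P ∈ sideLine T.v i ∧ Q ∈ sideLine T.v i := by
      have ht := T.minor_pos i
      have hsub := T.expLength_sub i
      rw [← hqdef] at hsub
      have key (a b : ℝ) : ∃ a' b' : ℝ,
          a • p + b • m = a' • T.unit (i + 1) + b' • T.unit (i + 2) := by
        refine ⟨(2 * T.minor i)⁻¹ * (b * q - a * T.type (i + 2) * q⁻¹),
          (2 * T.minor i)⁻¹ * (a - b * T.type (i + 1)), ?_⟩
        have hk : (2 * T.minor i)⁻¹ * (q - T.type (i + 1) * T.type (i + 2) * q⁻¹) = 1 := by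
          rw [hsub]; exact inv_mul_cancel₀ (by positivity)
        rw [hu, hw]
        funext j
        simp only [Pi.add_apply, Pi.smul_apply, smul_eq_mul]
        linear_combination (-(a * p j) - b * m j) * hk
      rw [mem_sideLine_iff, mem_sideLine_iff]
      refine ⟨⟨hPh, ?_⟩, hQh, ?_⟩
      · simpa using key 1 1
      · rw [hQ']; exact key _ _
    have e1 : ∀ x ∈ T.bodyBoundary (i + 1) ∩ sideLine T.v i, x = P := by
      rintro x ⟨hx, hx'⟩
      obtain ⟨a, b, rfl⟩ := hcomb x hx'
      exact eq_base_of_mem_bodyBoundary F hu hx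
    have e2 : ∀ x ∈ T.bodyBoundary (i + 2) ∩ sideLine T.v i, x = Q := by
      rintro x ⟨hx, hx'⟩
      obtain ⟨a, b, rfl⟩ := hcomb x hx'
      have h3 : a • p + b • m = (b * q) • (q⁻¹ • m) + (a * q⁻¹) • (q • p) := by
        rw [smul_smul, smul_smul, mul_assoc, mul_assoc, mul_inv_cancel₀ hq.ne',
          inv_mul_cancel₀ hq.ne', mul_one, mul_one, add_comm]
      rw [h3] at hx ⊢
      exact eq_base_of_mem_bodyBoundary F' hw' hx
    rw [if_neg hne, setDist_eq (A := T.bodyBoundary (i + 1) ∩ sideLine T.v i)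
      (B := T.bodyBoundary (i + 2) ∩ sideLine T.v i) ⟨hPb, hu2.1⟩ ⟨hQb, hu2.2⟩ hPQ1
      (fun x hx y hy => by rw [e1 x hx, e2 y hy]), hPQ, neg_neg, ← hcosh, ← Real.cosh_neg,
      Real.arcosh_cosh (neg_nonneg.2 (Real.log_nonpos hq.le hq1)), neg_neg]

theorem exp_length (i : Fin 3) : Real.exp (T.length i) = T.gram i + T.minor i := by
  rw [length_eq, Real.exp_log (T.expLength_pos i), expLength]

/-- The conjugate factor: `(c + t)(c - t) = ε_j ε_k`. The product form remains valid when a type is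
`0`. -/
theorem mul_exp_neg_length (i : Fin 3) :
    T.type (i + 1) * T.type (i + 2) * Real.exp (-T.length i) = T.gram i - T.minor i := by
  have h := T.expLength_add i
  rw [expLength, ← exp_length, ← Real.exp_neg, exp_length] at h
  linarith

theorem tau'_length (i : Fin 3) :
    tau' (T.type (i + 1) * T.type (i + 2)) (T.length i) = T.gram i := by
  rw [tau'_eq, mul_assoc, mul_exp_neg_length, exp_length]; ring

theorem tau_length (i : Fin 3) :
    tau (T.type (i + 1) * T.type (i + 2)) (T.length i) = T.minor i := by
  rw [tau, mul_assoc (1 / 2), mul_exp_neg_length, exp_length]; ring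

end GenTriangle

/-! ### Horocyclic arcs -/

theorem mem_hypPlane_of_mink_null_neg {x n : Vec} (hx : mink x x = -1) (hn : mink n n = 0)
    (hn0 : 0 < n 0) (h : mink x n < 0) : x ∈ hypPlane := by
  refine ⟨hx, ?_⟩
  by_contra hx0
  rcases lt_or_eq_of_le (not_lt.1 hx0) with h0 | h0
  · have := mink_neg_of_future (x := -x) (e := n) (by simp only [mink, Pi.neg_apply] at *; linarith)
      (by simpa using h0) hn.le hn0
    rw [mink_comm, mink_neg_right, mink_comm] at this
    linarith
  · simp only [mink, h0] at hx
    nlinarith [sq_nonneg (x 1), sq_nonneg (x 2)]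

/-- A parabolic arc in the direction `w` on the horocycle with centre `n` through `P`. -/
def horoCurve (P w n : Vec) (s : ℝ) : Vec :=
  P + s • w + (2 * mink P w * s + mink w w * s ^ 2) • n

section HoroArc

variable {P w n : Vec} {A : Set Vec}

theorem hasDerivAt_horoCurve_comp {σ : ℝ → ℝ} {σ' t : ℝ} (hσ : HasDerivAt σ σ' t) :
    HasDerivAt (fun t => horoCurve P w n (σ t))
      (σ' • w + (2 * mink P w * σ' + mink w w * (2 * σ t * σ')) • n) t := by
  have h1 := (hσ.smul_const w).const_add P
  have h2 := ((hσ.const_mul (2 * mink P w)).add ((hσ.pow 2).const_mul (mink w w))).smul_const n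
  have h3 := h1.add h2
  have h4 : σ' • w + (2 * mink P w * σ' + mink w w * (2 * σ t * σ')) • n =
      σ' • w + (2 * mink P w * σ' + mink w w * ((2 : ℕ) * σ t ^ (2 - 1) * σ')) • n := by
    norm_num
  rw [h4]
  exact h3

theorem contDiff_mink {γ : ℝ → Vec} (hγ : ContDiff ℝ 1 γ) (w : Vec) :
    ContDiff ℝ 1 fun t => mink (γ t) w := by
  have h := contDiff_pi.1 hγ
  unfold mink
  exact (((h 0).mul contDiff_const).neg.add ((h 1).mul contDiff_const)).add
    ((h 2).mul contDiff_const)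

/-- The parameter of the arc is an affine function of the point, so a `C¹` curve that traces the arc
has a `C¹` parameter function. -/
theorem mink_horoCurve_sub (hwn : mink w n = 0) (s : ℝ) :
    mink (horoCurve P w n s - P) w = mink w w * s := by
  have : horoCurve P w n s - P = s • w + (2 * mink P w * s + mink w w * s ^ 2) • n := by
    rw [horoCurve]; abel
  rw [this, mink_add_left, mink_smul_left, mink_smul_left, mink_comm n w, hwn]
  ring

/-- Along the arc the velocity is `σ' w` plus a multiple of `n`. That multiple adds nothing to the
speed, since `n` is null and orthogonal to `w`. -/
theorem curveLength_eq_of_image_horoCurve (hn : mink n n = 0) (hwn : mink w n = 0)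
    (hw : 0 < mink w w) {γ : ℝ → Vec} (hγ : ContDiff ℝ 1 γ)
    (himage : γ '' Set.Icc 0 1 = horoCurve P w n '' Set.Icc 0 1) :
    curveLength γ = (∫ t in (0 : ℝ)..1, |deriv (fun t => mink (γ t - P) w / mink w w) t|) *
      Real.sqrt (mink w w) := by
  set σ : ℝ → ℝ := fun t => mink (γ t - P) w / mink w w with hσ
  have hσC : ContDiff ℝ 1 σ := (contDiff_mink (hγ.sub contDiff_const) w).div_const _
  have hγσ : ∀ t ∈ Set.Icc (0 : ℝ) 1, γ t = horoCurve P w n (σ t) := by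
    intro t ht
    obtain ⟨s, -, hs⟩ : γ t ∈ horoCurve P w n '' Set.Icc 0 1 := himage ▸ ⟨t, ht, rfl⟩
    have : σ t = s := by
      simp only [hσ, ← hs, mink_horoCurve_sub hwn]
      field_simp
    rw [this, hs]
  rw [curveLength, ← intervalIntegral.integral_mul_const]
  -- The formula for `γ` holds only on `[0, 1]`, so its derivative is available only at interior
  -- points.
  refine intervalIntegral.integral_congr_Ioo_of_le zero_le_one fun t ht => ?_
  have hd := (hσC.differentiable one_ne_zero t).hasDerivAt
  have hγd : deriv γ t = _ :=
    (hasDerivAt_horoCurve_comp (P := P) (w := w) (n := n) hd).congr_of_eventuallyEq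
      (Filter.eventually_of_mem (Ioo_mem_nhds ht.1 ht.2) fun s hs => hγσ s (Set.Ioo_subset_Icc_self hs)) |>.deriv
  have hsq : mink (deriv γ t) (deriv γ t) = deriv σ t ^ 2 * mink w w := by
    rw [hγd]
    simp only [mink_add_left, mink_add_right, mink_smul_left, mink_smul_right, hn, hwn,
      mink_comm n w]
    ring
  simp only [hsq]
  rw [Real.sqrt_mul (sq_nonneg _), Real.sqrt_sq_eq_abs]

/-- The curve itself attains the value. For any competitor the parameter function takes the values
`0` and `1`, so its total variation is at least `1`. -/
theorem arcLength_horoCurve (hn : mink n n = 0) (hwn : mink w n = 0) (hw : 0 < mink w w) :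
    arcLength (horoCurve P w n '' Set.Icc 0 1) = Real.sqrt (mink w w) := by
  have hsqrt := Real.sqrt_nonneg (mink w w)
  refine IsLeast.csInf_eq ⟨⟨horoCurve P w n, ?_, ?_, rfl, ?_⟩, ?_⟩
  · unfold horoCurve
    fun_prop
  · intro s _ t _ hst
    have h1 := mink_horoCurve_sub (P := P) hwn s
    rw [show horoCurve P w n s = horoCurve P w n t from hst, mink_horoCurve_sub hwn] at h1
    exact (mul_left_cancel₀ hw.ne' h1).symm
  · rw [curveLength_eq_of_image_horoCurve hn hwn hw (by unfold horoCurve; fun_prop) rfl]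
    have : (fun t => mink (horoCurve P w n t - P) w / mink w w) = fun t => t := by
      funext t
      rw [mink_horoCurve_sub hwn]; field_simp
    rw [this]
    simp
  · rintro L ⟨γ, hγ, -, himage, rfl⟩
    rw [curveLength_eq_of_image_horoCurve hn hwn hw hγ himage]
    set σ : ℝ → ℝ := fun t => mink (γ t - P) w / mink w w with hσ
    have hσC : ContDiff ℝ 1 σ := (contDiff_mink (hγ.sub contDiff_const) w).div_const _
    have hval : ∀ s ∈ Set.Icc (0 : ℝ) 1, ∃ t ∈ Set.Icc (0 : ℝ) 1, σ t = s := by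
      intro s hs
      obtain ⟨t, ht, hts⟩ : horoCurve P w n s ∈ γ '' Set.Icc 0 1 := himage ▸ ⟨s, hs, rfl⟩
      refine ⟨t, ht, ?_⟩
      simp only [hσ, hts, mink_horoCurve_sub hwn]
      field_simp
    obtain ⟨t₀, ht₀, h0⟩ := hval 0 ⟨le_rfl, zero_le_one⟩
    obtain ⟨t₁, ht₁, h1⟩ := hval 1 ⟨zero_le_one, le_rfl⟩
    have hcont : Continuous (deriv σ) := hσC.continuous_deriv le_rfl
    have hint : ∫ t in t₀..t₁, deriv σ t = 1 := by
      rw [intervalIntegral.integral_deriv_eq_sub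
        (fun t _ => hσC.differentiable one_ne_zero t) (hcont.intervalIntegrable _ _), h0, h1,
        sub_zero]
    have hle : 1 ≤ ∫ t in (0 : ℝ)..1, |deriv σ t| := by
      have hsub : Set.uIoc t₀ t₁ ⊆ Set.uIoc (0 : ℝ) 1 := by
        rw [Set.uIoc_of_le (zero_le_one (α := ℝ)), Set.uIoc]
        exact Set.Ioc_subset_Ioc (le_min ht₀.1 ht₁.1) (max_le ht₀.2 ht₁.2)
      have h2 := intervalIntegral.abs_integral_mono_interval (f := fun t => |deriv σ t|)
        (μ := MeasureTheory.volume) hsub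
        (Filter.Eventually.of_forall fun t => abs_nonneg (deriv σ t))
        (hcont.abs.intervalIntegrable 0 1)
      have h3 := intervalIntegral.norm_integral_le_abs_integral_norm (f := deriv σ) (a := t₀)
        (b := t₁) (μ := MeasureTheory.volume)
      simp only [Real.norm_eq_abs, hint, abs_one] at h3
      rw [abs_of_nonneg (a := ∫ t in (0 : ℝ)..1, |deriv σ t|)
        (intervalIntegral.integral_nonneg zero_le_one fun t _ => abs_nonneg _)] at h2
      exact h3.trans h2
    nlinarith

end HoroArc

/-! ### Common perpendiculars -/

/-- The points have coordinates on hyperbolas, `a² = 1 + b²` and `c² = 1 + d²`, so `bd ≤ ac - 1`.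
The product `ac⟨P, Q⟩ + bd` then exceeds `⟨P, Q⟩` by at most `(ac - 1)(⟨P, Q⟩ + 1) ≤ 0`. -/
theorem mink_le_of_common_perpendicular {P Q u : Vec} (hP : P ∈ hypPlane) (hQ : Q ∈ hypPlane)
    (hu : mink u u = 1) (hPu : mink P u = 0) (hQu : mink Q u = 0) {a b c d : ℝ}
    (hx : a • P + b • u ∈ hypPlane) (hy : c • Q + d • u ∈ hypPlane) :
    mink (a • P + b • u) (c • Q + d • u) ≤ mink P Q := by
  have huP : mink u P = 0 := by rw [mink_comm, hPu]
  have huQ : mink u Q = 0 := by rw [mink_comm, hQu]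
  have hPQ := mink_le_neg_one hP hQ
  have h1 := hx.1
  have h2 := hy.1
  have h3 := mink_le_neg_one hx hP
  have h4 := mink_le_neg_one hy hQ
  simp only [mink_add_left, mink_add_right, mink_smul_left, mink_smul_right, hP.1, hQ.1, hu, hPu,
    hQu, huP, huQ] at h1 h2 h3 h4 ⊢
  have ha : 1 ≤ a := by linarith
  have hc : 1 ≤ c := by linarith
  have hcs : 1 + b * d ≤ a * c := by
    have h5 : (1 + b * d) ^ 2 ≤ (a * c) ^ 2 := by
      have h6 : a ^ 2 = 1 + b ^ 2 := by linarith
      have h7 : c ^ 2 = 1 + d ^ 2 := by linarith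
      rw [mul_pow, h6, h7]
      linarith [sq_nonneg (b - d)]
    exact le_of_sq_le_sq h5 (by positivity)
  have hac : 1 ≤ a * c := one_le_mul_of_one_le_of_one_le ha hc
  have := mul_le_mul_of_nonneg_left hPQ (sub_nonneg.2 hac)
  linarith

namespace GenTriangle

variable (T : GenTriangle)

/-! ### The angles -/

theorem add_one_add_one (i : Fin 3) : i + 1 + 1 = i + 2 := by revert i; decide
theorem add_one_add_two (i : Fin 3) : i + 1 + 2 = i := by revert i; decide
theorem add_two_add_one (i : Fin 3) : i + 2 + 1 = i := by revert i; decide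
theorem add_two_add_two (i : Fin 3) : i + 2 + 2 = i + 1 := by revert i; decide

theorem mink_unit_left (i : Fin 3) : mink (T.unit i) (T.unit (i + 1)) = -T.gram (i + 2) := by
  rw [gram, add_two_add_one, add_two_add_two, neg_neg]

theorem mink_unit_right' (i : Fin 3) : mink (T.unit i) (T.unit (i + 2)) = -T.gram (i + 1) := by
  rw [gram, add_one_add_one, add_one_add_two, neg_neg, mink_comm]

theorem minor_sq_left (i : Fin 3) :
    T.minor (i + 1) ^ 2 = T.gram (i + 1) ^ 2 - T.type i * T.type (i + 2) := by
  rw [minor_sq, add_one_add_one, add_one_add_two, mul_comm (T.type (i + 2))]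

theorem minor_sq_right (i : Fin 3) :
    T.minor (i + 2) ^ 2 = T.gram (i + 2) ^ 2 - T.type i * T.type (i + 1) := by
  rw [minor_sq, add_two_add_one, add_two_add_two]

/-- Jacobi's identity for a minor of the adjugate. It becomes `cos² + sin² = 1` or `cosh² - sinh² =
1` according to `ε_i`. -/
theorem minor_sq_mul_minor_sq (i : Fin 3) :
    (T.minor (i + 1) * T.minor (i + 2)) ^ 2 =
      (T.gram (i + 1) * T.gram (i + 2) - T.type i * T.gram i) ^ 2 + T.type i * T.gramDet := by
  rw [mul_pow, minor_sq_left, minor_sq_right, T.gramDet_rotate i]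
  ring

theorem hypAngle_unit {i : Fin 3} (h : T.type i = 1) :
    hypAngle (toHyp (T.v i)) (T.v (i + 1)) (T.v (i + 2)) =
      Real.arccos ((T.gram (i + 1) * T.gram (i + 2) - T.gram i) /
        (T.minor (i + 1) * T.minor (i + 2))) := by
  have s0 := T.mink_unit_self i
  have s1 := T.mink_unit_self (i + 1)
  have s2 := T.mink_unit_self (i + 2)
  have g0 := T.mink_unit_unit i
  have g1 := T.mink_unit_right' i
  have g2 := T.mink_unit_left i
  have m1 := T.minor_sq_left i
  have m2 := T.minor_sq_right i
  have p1 := T.minor_pos (i + 1)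
  have p2 := T.minor_pos (i + 2)
  have c1 := T.scale_pos (i + 1)
  have c2 := T.scale_pos (i + 2)
  rw [h] at s0 m1 m2
  have n1 : mink (tangentPart (T.unit i) (T.v (i + 1))) (tangentPart (T.unit i) (T.v (i + 1))) =
      (T.scale (i + 1) * T.minor (i + 2)) ^ 2 := by
    rw [mul_pow, m2, T.v_eq (i + 1)]
    simp only [tangentPart, mink_add_left, mink_add_right, mink_smul_left, mink_smul_right, s0, s1,
      g2, mink_comm (T.unit (i + 1)) (T.unit i)]
    ring
  have n2 : mink (tangentPart (T.unit i) (T.v (i + 2))) (tangentPart (T.unit i) (T.v (i + 2))) =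
      (T.scale (i + 2) * T.minor (i + 1)) ^ 2 := by
    rw [mul_pow, m1, T.v_eq (i + 2)]
    simp only [tangentPart, mink_add_left, mink_add_right, mink_smul_left, mink_smul_right, s0, s2,
      g1, mink_comm (T.unit (i + 2)) (T.unit i)]
    ring
  have n3 : mink (tangentPart (T.unit i) (T.v (i + 1))) (tangentPart (T.unit i) (T.v (i + 2))) =
      T.scale (i + 1) * T.scale (i + 2) * (T.gram (i + 1) * T.gram (i + 2) - T.gram i) := by
    rw [T.v_eq (i + 1), T.v_eq (i + 2)]
    simp only [tangentPart, mink_add_left, mink_add_right, mink_smul_left, mink_smul_right, s0, g0,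
      g1, g2, mink_comm (T.unit (i + 1)) (T.unit i), mink_comm (T.unit (i + 2)) (T.unit i)]
    ring
  rw [hypAngle, toHyp_v h, n1, n2, n3, Real.sqrt_sq (by positivity), Real.sqrt_sq (by positivity)]
  congr 1
  field_simp

/-- The points where the polar geodesic of a vertex outside the closed disc meets the sides through
that vertex. -/
theorem perpendicular_foot {i : Fin 3} (h : T.type i = -1) :
    ((T.minor (i + 1))⁻¹ • (T.unit (i + 2) + T.gram (i + 1) • T.unit i) ∈ hypPlane) ∧
      (T.minor (i + 2))⁻¹ • (T.unit (i + 1) + T.gram (i + 2) • T.unit i) ∈ hypPlane := by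
  have s0 := T.mink_unit_self i
  have s1 := T.mink_unit_self (i + 1)
  have s2 := T.mink_unit_self (i + 2)
  have g1 := T.mink_unit_right' i
  have g2 := T.mink_unit_left i
  have m1 := T.minor_sq_left i
  have m2 := T.minor_sq_right i
  have p1 := T.minor_pos (i + 1)
  have p2 := T.minor_pos (i + 2)
  -- The coefficient at the vertex other than `i` must be positive: up to sign and a minor it is the
  -- product of the edge point with the foot. The cyclic order puts it on the left on `L_{i+1}` and
  -- on the right on `L_{i+2}`.
  obtain ⟨a, b, ha, -, hx⟩ := T.exists_edge_point_left (i + 1)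
  obtain ⟨c, d, -, hd, hy⟩ := T.exists_edge_point_right (i + 2)
  rw [add_one_add_one, add_one_add_two] at hx
  rw [add_two_add_one, add_two_add_two] at hy
  rw [h] at s0 m1 m2
  constructor
  · refine mem_hypPlane_of_mink_neg hx.1 ?_ ?_
    · simp only [mink_add_left, mink_add_right, mink_smul_left, mink_smul_right, s0, s2, g1,
        mink_comm (T.unit (i + 2)) (T.unit i)]
      field_simp
      linarith
    · have : mink (a • T.unit (i + 2) + b • T.unit i)
          ((T.minor (i + 1))⁻¹ • (T.unit (i + 2) + T.gram (i + 1) • T.unit i)) =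
          -(a * T.minor (i + 1)) := by
        simp only [mink_add_left, mink_add_right, mink_smul_left, mink_smul_right, s0, s2, g1,
          mink_comm (T.unit (i + 2)) (T.unit i)]
        field_simp
        linear_combination a * m1
      rw [this]
      have := mul_pos ha p1
      linarith
  · refine mem_hypPlane_of_mink_neg hy.1 ?_ ?_
    · simp only [mink_add_left, mink_add_right, mink_smul_left, mink_smul_right, s0, s1, g2,
        mink_comm (T.unit (i + 1)) (T.unit i)]
      field_simp
      linarith
    · have : mink (c • T.unit i + d • T.unit (i + 1))
          ((T.minor (i + 2))⁻¹ • (T.unit (i + 1) + T.gram (i + 2) • T.unit i)) =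
          -(d * T.minor (i + 2)) := by
        simp only [mink_add_left, mink_add_right, mink_smul_left, mink_smul_right, s0, s1, g2,
          mink_comm (T.unit (i + 1)) (T.unit i)]
        field_simp
        linear_combination d * m2
      rw [this]
      have := mul_pos hd p2
      linarith

theorem setDist_sides {i : Fin 3} (h : T.type i = -1) :
    1 ≤ (T.gram (i + 1) * T.gram (i + 2) + T.gram i) / (T.minor (i + 1) * T.minor (i + 2)) ∧
    setDist (sideLine T.v (i + 1)) (sideLine T.v (i + 2)) =
      Real.arcosh ((T.gram (i + 1) * T.gram (i + 2) + T.gram i) /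
        (T.minor (i + 1) * T.minor (i + 2))) := by
  obtain ⟨hP, hQ⟩ := T.perpendicular_foot h
  have s0 := T.mink_unit_self i
  have g0 := T.mink_unit_unit' i
  have g1 := T.mink_unit_right' i
  have g2 := T.mink_unit_left i
  have p1 := T.minor_pos (i + 1)
  have p2 := T.minor_pos (i + 2)
  have g1' : mink (T.unit (i + 2)) (T.unit i) = -T.gram (i + 1) := by rw [mink_comm, g1]
  have hm1 := T.mem_sideLine_iff (i + 1)
  have hm2 := T.mem_sideLine_iff (i + 2)
  rw [add_one_add_one, add_one_add_two] at hm1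
  rw [add_two_add_one, add_two_add_two] at hm2
  rw [h, neg_neg] at s0
  set P := (T.minor (i + 1))⁻¹ • (T.unit (i + 2) + T.gram (i + 1) • T.unit i) with hPdef
  set Q := (T.minor (i + 2))⁻¹ • (T.unit (i + 1) + T.gram (i + 2) • T.unit i) with hQdef
  have hPu : mink P (T.unit i) = 0 := by
    rw [hPdef]
    simp only [mink_add_left, mink_smul_left, s0, g1']
    ring
  have hQu : mink Q (T.unit i) = 0 := by
    rw [hQdef]
    simp only [mink_add_left, mink_smul_left, s0, mink_comm (T.unit (i + 1)) (T.unit i), g2]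
    ring
  have hPQ : mink P Q = -((T.gram (i + 1) * T.gram (i + 2) + T.gram i) /
      (T.minor (i + 1) * T.minor (i + 2))) := by
    rw [hPdef, hQdef]
    simp only [mink_add_left, mink_add_right, mink_smul_left, mink_smul_right, s0, g0, g1', g2]
    field_simp
    ring
  have hle := mink_le_neg_one hP hQ
  refine ⟨by linarith, ?_⟩
  have hPm : P ∈ sideLine T.v (i + 1) :=
    (hm1 _).2 ⟨hP, _, _, by rw [hPdef, smul_add, smul_smul]⟩
  have hQm : Q ∈ sideLine T.v (i + 2) :=
    (hm2 _).2 ⟨hQ, _, _, by rw [hQdef, smul_add, smul_smul, add_comm]⟩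
  rw [setDist_eq hPm hQm hle, hPQ, neg_neg]
  intro x hx y hy
  obtain ⟨hx, a, b, rfl⟩ := (hm1 _).1 hx
  obtain ⟨hy, c, d, rfl⟩ := (hm2 _).1 hy
  have ex : a • T.unit (i + 2) + b • T.unit i =
      (a * T.minor (i + 1)) • P + (b - a * T.gram (i + 1)) • T.unit i := by
    rw [hPdef]
    funext l
    simp only [Pi.add_apply, Pi.smul_apply, smul_eq_mul]
    field_simp
    ring
  have ey : c • T.unit i + d • T.unit (i + 1) =
      (d * T.minor (i + 2)) • Q + (c - d * T.gram (i + 2)) • T.unit i := by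
    rw [hQdef]
    funext l
    simp only [Pi.add_apply, Pi.smul_apply, smul_eq_mul]
    field_simp
    ring
  rw [ex] at hx ⊢
  rw [ey] at hy ⊢
  exact mink_le_of_common_perpendicular hP hQ s0 hPu hQu hx hy

theorem mem_sector_iff (i : Fin 3) (x : Vec) :
    x ∈ T.sector i ↔ x ∈ hypPlane ∧ ∃ a b c : ℝ, 0 ≤ b ∧ 0 ≤ c ∧
      x = a • T.unit i + b • T.unit (i + 1) + c • T.unit (i + 2) := by
  have h0 := T.scale_pos i
  have h1 := T.scale_pos (i + 1)
  have h2 := T.scale_pos (i + 2)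
  refine and_congr_right fun _ => ?_
  constructor
  · rintro ⟨a, b, c, hb, hc, rfl⟩
    exact ⟨a * T.scale i, b * T.scale (i + 1), c * T.scale (i + 2), by positivity, by positivity,
      by rw [v_eq, v_eq, v_eq, smul_smul, smul_smul, smul_smul]⟩
  · rintro ⟨a, b, c, hb, hc, rfl⟩
    exact ⟨a * (T.scale i)⁻¹, b * (T.scale (i + 1))⁻¹, c * (T.scale (i + 2))⁻¹, by positivity,
      by positivity, by rw [unit, unit, unit, smul_smul, smul_smul, smul_smul]⟩

theorem arcLength_cusp {i : Fin 3} (h : T.type i = 0) :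
    arcLength (T.bodyBoundary i ∩ T.sector i) =
      Real.sqrt T.gramDet / (2 * (T.gram (i + 1) * T.gram (i + 2))) := by
  have s0 := T.mink_unit_self i
  have s1 := T.mink_unit_self (i + 1)
  have s2 := T.mink_unit_self (i + 2)
  have g0 := T.mink_unit_unit i
  have g0' := T.mink_unit_unit' i
  have g1 := T.mink_unit_right' i
  have g2 := T.mink_unit_left i
  have g1' : mink (T.unit (i + 2)) (T.unit i) = -T.gram (i + 1) := by rw [mink_comm, g1]
  have g2' : mink (T.unit (i + 1)) (T.unit i) = -T.gram (i + 2) := by rw [mink_comm, g2]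
  have p1 := T.gram_pos (i + 1)
  have p2 := T.gram_pos (i + 2)
  have hfut := unit_future h.ge
  have hdet := T.gramDet_rotate i
  have hdetpos := T.gramDet_pos
  have hb := bodyBoundary_of_type_zero h
  have hs := T.mem_sector_iff i
  rw [h] at s0 hdet
  rw [neg_zero] at s0
  generalize T.unit i = n at *
  generalize T.unit (i + 1) = u at *
  generalize T.unit (i + 2) = v at *
  generalize T.gram (i + 1) = c at *
  generalize T.gram (i + 2) = d at *
  -- The curve will run from `P`, on the side through `n` and `u`, to the side through `n` and `v`.
  -- The coefficients of `u` and `v` are forced by the value `-1/2` of the product with `n`, that of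
  -- `n` in `P` by `⟨P, P⟩ = -1`.
  obtain ⟨w, hw⟩ : ∃ w, w = (2 * c)⁻¹ • v - (2 * d)⁻¹ • u := ⟨_, rfl⟩
  obtain ⟨P, hP⟩ : ∃ P, P = (1 - T.type (i + 1) / (4 * d ^ 2)) • n + (2 * d)⁻¹ • u := ⟨_, rfl⟩
  have hwn : mink w n = 0 := by
    rw [hw]
    simp only [mink_sub_left, mink_smul_left, g1', g2']
    field_simp
    ring
  have hww : mink w w = T.gramDet / (2 * (c * d)) ^ 2 := by
    rw [hw, hdet]
    simp only [mink_sub_left, mink_sub_right, mink_smul_left, mink_smul_right, s1, s2, g0, g0']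
    field_simp
    ring
  have hPn : mink P n = -1 / 2 := by
    rw [hP]
    simp only [mink_add_left, mink_smul_left, g2', s0]
    field_simp
    ring
  have hPP : mink P P = -1 := by
    rw [hP]
    simp only [mink_add_left, mink_add_right, mink_smul_left, mink_smul_right, s0, s1, g2, g2']
    field_simp
    ring
  have hnw : mink n w = 0 := by rw [mink_comm, hwn]
  have hnP : mink n P = -1 / 2 := by rw [mink_comm, hPn]
  have hset : T.bodyBoundary i ∩ T.sector i = horoCurve P w n '' Set.Icc 0 1 := by
    rw [hb]
    ext x
    constructor
    · rintro ⟨⟨hxh, hxn⟩, hxs⟩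
      obtain ⟨-, a, β, γ, hβ, hγ, hx⟩ := (hs x).1 hxs
      have h1 : d * β + c * γ = 1 / 2 := by
        rw [hx] at hxn
        simp only [mink_add_left, mink_smul_left, s0, g1', g2'] at hxn
        linarith
      have hcγ := mul_nonneg p1.le hγ
      have hdβ := mul_nonneg p2.le hβ
      -- At parameter `s` the curve has coefficient `s / (2c)` at `v`. Nonnegativity of the
      -- coefficients at `u` and `v` is exactly `0 ≤ s ≤ 1`.
      refine ⟨2 * c * γ, ⟨by linarith, by linarith⟩, ?_⟩
      have hx' : x = P + (2 * c * γ) • w + (a - (1 - T.type (i + 1) / (4 * d ^ 2))) • n := by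
        have hβ' : β = (1 / 2 - c * γ) / d := by
          field_simp; linarith
        rw [hx, hP, hw, hβ']
        funext l
        simp only [Pi.add_apply, Pi.sub_apply, Pi.smul_apply, smul_eq_mul]
        field_simp
        ring
      generalize a - (1 - T.type (i + 1) / (4 * d ^ 2)) = a' at hx'
      have h2 := hxh.1
      rw [hx'] at h2 ⊢
      simp only [mink_add_left, mink_add_right, mink_smul_left, mink_smul_right, hPP, hPn, hnP,
        hwn, hnw, s0, mink_comm w P] at h2
      rw [horoCurve]
      congr 2
      linarith
    · rintro ⟨s, ⟨hs0, hs1⟩, rfl⟩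
      have hxx : mink (horoCurve P w n s) (horoCurve P w n s) = -1 := by
        simp only [horoCurve, mink_add_left, mink_add_right, mink_smul_left, mink_smul_right, hPP,
          hPn, hnP, hwn, hnw, s0, mink_comm w P]
        ring
      have hxn : mink (horoCurve P w n s) n = -1 / 2 := by
        simp only [horoCurve, mink_add_left, mink_smul_left, hPn, hwn, s0]
        ring
      have hh := mem_hypPlane_of_mink_null_neg hxx s0 hfut (by rw [hxn]; norm_num)
      refine ⟨⟨hh, by rw [hxn]; norm_num⟩, (hs _).2 ⟨hh,
        1 - T.type (i + 1) / (4 * d ^ 2) + (2 * mink P w * s + mink w w * s ^ 2),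
        (1 - s) * (2 * d)⁻¹, s * (2 * c)⁻¹, ?_, by positivity, ?_⟩⟩
      · have := sub_nonneg.2 hs1
        positivity
      · rw [horoCurve]
        generalize 2 * mink P w * s + mink w w * s ^ 2 = r
        rw [hP, hw]
        funext l
        simp only [Pi.add_apply, Pi.sub_apply, Pi.smul_apply, smul_eq_mul]
        ring
  rw [hset, arcLength_horoCurve s0 hwn (by rw [hww]; positivity), hww,
    Real.sqrt_div' _ (by positivity), Real.sqrt_sq (by positivity)]

end GenTriangle

namespace GenTriangle

variable (T : GenTriangle)

/-! ### The functions `ρ`, `ρ'` of the angles in terms of the Gram matrix -/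

theorem angle_of_type_one {i : Fin 3} (h : T.type i = 1) : T.angle i =
    Real.arccos ((T.gram (i + 1) * T.gram (i + 2) - T.gram i) /
      (T.minor (i + 1) * T.minor (i + 2))) := by
  rw [angle, if_pos (type_eq_one_iff.1 h), hypAngle_unit T h]

theorem minor_of_type_zero {i : Fin 3} (h : T.type i = 0) :
    T.minor (i + 1) = T.gram (i + 1) ∧ T.minor (i + 2) = T.gram (i + 2) := by
  have h1 := T.minor_sq_left i
  have h2 := T.minor_sq_right i
  rw [h, zero_mul, sub_zero] at h1 h2
  exact ⟨(sq_eq_sq₀ (T.minor_pos _).le (T.gram_pos _).le).1 h1,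
    (sq_eq_sq₀ (T.minor_pos _).le (T.gram_pos _).le).1 h2⟩

theorem angle_of_type_zero {i : Fin 3} (h : T.type i = 0) :
    T.angle i = Real.sqrt T.gramDet / (T.gram (i + 1) * T.gram (i + 2)) := by
  have h0 := type_eq_zero_iff.1 h
  have p1 := T.gram_pos (i + 1)
  have p2 := T.gram_pos (i + 2)
  rw [angle, if_neg (by rw [h0]; exact lt_irrefl _), if_pos h0, arcLength_cusp T h]
  field_simp

theorem angle_of_type_neg_one {i : Fin 3} (h : T.type i = -1) : T.angle i =
    Real.arcosh ((T.gram (i + 1) * T.gram (i + 2) + T.gram i) /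
      (T.minor (i + 1) * T.minor (i + 2))) := by
  have h0 := type_eq_neg_one_iff.1 h
  rw [angle, if_neg h0.not_gt, if_neg h0.ne', (setDist_sides T h).2]

theorem rho_angle (i : Fin 3) : rho (T.type i) (T.angle i) =
    Real.sqrt T.gramDet / (T.minor (i + 1) * T.minor (i + 2)) := by
  have hsq := T.minor_sq_mul_minor_sq i
  have p1 := T.minor_pos (i + 1)
  have p2 := T.minor_pos (i + 2)
  have hM : 0 < T.minor (i + 1) * T.minor (i + 2) := mul_pos p1 p2
  rcases T.type_cases i with h | h | h
  · rw [h, rho_one, angle_of_type_one T h, Real.sin_arccos]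
    rw [h] at hsq
    have : 1 - ((T.gram (i + 1) * T.gram (i + 2) - T.gram i) /
        (T.minor (i + 1) * T.minor (i + 2))) ^ 2 =
        T.gramDet / (T.minor (i + 1) * T.minor (i + 2)) ^ 2 := by
      rw [div_pow, eq_div_iff (by positivity), sub_mul, div_mul_cancel₀ _ (by positivity)]
      linarith
    rw [this, Real.sqrt_div' _ (by positivity), Real.sqrt_sq hM.le]
  · obtain ⟨h1, h2⟩ := T.minor_of_type_zero h
    rw [h, rho_zero, angle_of_type_zero T h, h1, h2]
  · rw [h, rho_neg_one, angle_of_type_neg_one T h, Real.sinh_arcosh (T.setDist_sides h).1]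
    rw [h] at hsq
    have : ((T.gram (i + 1) * T.gram (i + 2) + T.gram i) /
        (T.minor (i + 1) * T.minor (i + 2))) ^ 2 - 1 =
        T.gramDet / (T.minor (i + 1) * T.minor (i + 2)) ^ 2 := by
      rw [div_pow, eq_div_iff (by positivity), sub_mul, div_mul_cancel₀ _ (by positivity)]
      linarith
    rw [this, Real.sqrt_div' _ (by positivity), Real.sqrt_sq hM.le]

theorem rho'_angle (i : Fin 3) : rho' (T.type i) (T.angle i) =
    (T.gram (i + 1) * T.gram (i + 2) - T.type i * T.gram i) /
      (T.minor (i + 1) * T.minor (i + 2)) := by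
  have hsq := T.minor_sq_mul_minor_sq i
  have p1 := T.minor_pos (i + 1)
  have p2 := T.minor_pos (i + 2)
  have hM : 0 < T.minor (i + 1) * T.minor (i + 2) := mul_pos p1 p2
  rcases T.type_cases i with h | h | h
  · rw [h] at hsq
    have hle : |(T.gram (i + 1) * T.gram (i + 2) - T.gram i) /
        (T.minor (i + 1) * T.minor (i + 2))| ≤ 1 := by
      rw [abs_div, abs_of_pos hM, div_le_one hM]
      exact abs_le_of_sq_le_sq (by linarith [T.gramDet_pos]) hM.le
    rw [h, rho'_one, angle_of_type_one T h, Real.cos_arccos (abs_le.1 hle).1 (abs_le.1 hle).2,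
      one_mul]
  · obtain ⟨h1, h2⟩ := T.minor_of_type_zero h
    rw [h, rho'_zero, h1, h2, zero_mul, sub_zero, div_self]
    exact (mul_pos (T.gram_pos _) (T.gram_pos _)).ne'
  · rw [h, rho'_neg_one, angle_of_type_neg_one T h, Real.cosh_arcosh (T.setDist_sides h).1]
    congr 1
    ring

/-- For `ε_i = ±1`, `ε_i` times the sum of the two exponential terms is half of `(c_j + t_j)(c_k -
t_k) + (c_k + t_k)(c_j - t_j)`, that is `c_j c_k - t_j t_k`, and a double angle formula concludes.
-/
theorem rho_half_angle (i : Fin 3) : 2 * rho (T.type i) (T.angle i / 2) ^ 2 =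
    (T.gram i - 1 / 2 * T.type (i + 1) * Real.exp (T.length (i + 1) - T.length (i + 2))
      - 1 / 2 * T.type (i + 2) * Real.exp (T.length (i + 2) - T.length (i + 1))) /
      (T.minor (i + 1) * T.minor (i + 2)) := by
  have p1 := T.minor_pos (i + 1)
  have p2 := T.minor_pos (i + 2)
  have hM : T.minor (i + 1) * T.minor (i + 2) ≠ 0 := (mul_pos p1 p2).ne'
  have hrho := T.rho'_angle i
  have e1 := T.exp_length (i + 1)
  have e2 := T.exp_length (i + 2)
  have n1 := T.mul_exp_neg_length (i + 1)
  have n2 := T.mul_exp_neg_length (i + 2)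
  rw [add_one_add_one, add_one_add_two] at n1
  rw [add_two_add_one, add_two_add_two] at n2
  rw [sub_eq_add_neg (T.length (i + 1)), sub_eq_add_neg (T.length (i + 2)), Real.exp_add,
    Real.exp_add, e1, e2]
  rcases T.type_cases i with h | h | h
  · rw [h, rho'_one, eq_div_iff hM] at hrho
    rw [h] at n1 n2
    rw [h, rho_one, eq_div_iff hM]
    have hc : Real.cos (T.angle i) = 1 - 2 * Real.sin (T.angle i / 2) ^ 2 := by
      rw [← Real.cos_two_mul_eq_one_sub]
      congr 1
      ring
    rw [hc] at hrho
    linear_combination -hrho + (T.gram (i + 1) + T.minor (i + 1)) / 2 * n2 +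
      (T.gram (i + 2) + T.minor (i + 2)) / 2 * n1
  -- Here `n1` and `n2` degenerate because their factor `ε_i` vanishes, but `t = c` gives `e^l = 2c`
  -- on both adjacent edges.
  · obtain ⟨h1, h2⟩ := T.minor_of_type_zero h
    have hg1 := T.gram_pos (i + 1)
    have hg2 := T.gram_pos (i + 2)
    have hdet := T.gramDet_rotate i
    have hpos := T.gramDet_pos
    rw [h] at hdet
    rw [h, rho_zero, angle_of_type_zero T h, Real.exp_neg, Real.exp_neg, e1, e2, h1, h2, div_pow,
      div_pow, Real.sq_sqrt hpos.le, hdet]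
    field_simp
    ring
  · rw [h, rho'_neg_one, eq_div_iff hM] at hrho
    rw [h] at n1 n2
    rw [h, rho_neg_one, eq_div_iff hM]
    have hc : Real.cosh (T.angle i) = 1 + 2 * Real.sinh (T.angle i / 2) ^ 2 := by
      have h1 := Real.cosh_two_mul (T.angle i / 2)
      rw [Real.cosh_sq, mul_div_cancel₀ _ two_ne_zero] at h1
      linarith
    rw [hc] at hrho
    linear_combination hrho - (T.gram (i + 1) + T.minor (i + 1)) / 2 * n2 -
      (T.gram (i + 2) + T.minor (i + 2)) / 2 * n1

/-! ### Arbitrary labellings of the vertices -/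

theorem labelling {i j k : Fin 3} (hij : i ≠ j) (hjk : j ≠ k) (hki : k ≠ i) :
    (j = i + 1 ∧ k = i + 2) ∨ (j = i + 2 ∧ k = i + 1) := by
  revert i j k; decide

/-- The lengths and angles in terms of the Gram matrix, for any labelling of the vertices. -/
theorem gram_laws {i j k : Fin 3} (hij : i ≠ j) (hjk : j ≠ k) (hki : k ≠ i) :
    tau (T.type j * T.type k) (T.length i) = T.minor i ∧
    tau' (T.type j * T.type k) (T.length i) = T.gram i ∧
    T.minor i ^ 2 = T.gram i ^ 2 - T.type j * T.type k ∧
    rho (T.type i) (T.angle i) = Real.sqrt T.gramDet / (T.minor j * T.minor k) ∧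
    rho' (T.type i) (T.angle i) =
      (T.gram j * T.gram k - T.type i * T.gram i) / (T.minor j * T.minor k) ∧
    2 * rho (T.type i) (T.angle i / 2) ^ 2 =
      (T.gram i - 1 / 2 * T.type j * Real.exp (T.length j - T.length k)
        - 1 / 2 * T.type k * Real.exp (T.length k - T.length j)) / (T.minor j * T.minor k) ∧
    T.gramDet = T.type i * T.type j * T.type k + 2 * T.gram i * T.gram j * T.gram k
      - T.type i * T.gram i ^ 2 - T.type j * T.gram j ^ 2 - T.type k * T.gram k ^ 2 := by
  rcases labelling hij hjk hki with ⟨rfl, rfl⟩ | ⟨rfl, rfl⟩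
  · exact ⟨T.tau_length i, T.tau'_length i, T.minor_sq i, T.rho_angle i, T.rho'_angle i,
      T.rho_half_angle i, T.gramDet_rotate i⟩
  · rw [mul_comm (T.type (i + 2)), mul_comm (T.minor (i + 2)), mul_comm (T.gram (i + 2))]
    refine ⟨T.tau_length i, T.tau'_length i, T.minor_sq i, T.rho_angle i, T.rho'_angle i, ?_, ?_⟩
    · rw [T.rho_half_angle i]; ring
    · rw [T.gramDet_rotate i]; ring

end GenTriangle

end

/-! ### The four laws -/

theorem mainTheorem4 (T : GenTriangle) (ε θ l : Fin 3 → ℝ)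
    (hε : ∀ i, ε i = T.type i) (hθ : ∀ i, θ i = T.angle i) (hl : ∀ i, l i = T.length i) :
    (∀ i : Fin 3, rho (ε i) (θ i) ≠ 0) ∧
    ∀ i j k : Fin 3, i ≠ j → j ≠ k → k ≠ i →
      tau (ε j * ε k) (l i) ≠ 0 ∧
      tau' (ε j * ε k) (l i) =
        (rho' (ε i) (θ i) + rho' (ε j) (θ j) * rho' (ε k) (θ k)) /
          (rho (ε j) (θ j) * rho (ε k) (θ k)) ∧
      2 * rho (ε i) (θ i / 2) ^ 2 =
        (tau' (ε j * ε k) (l i) - 1 / 2 * ε j * Real.exp (l j - l k)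
            - 1 / 2 * ε k * Real.exp (l k - l j)) /
          (tau (ε k * ε i) (l j) * tau (ε i * ε j) (l k)) ∧
      rho' (ε i) (θ i) =
        (-(ε i) * tau' (ε j * ε k) (l i) + tau' (ε k * ε i) (l j) * tau' (ε i * ε j) (l k)) /
          (tau (ε k * ε i) (l j) * tau (ε i * ε j) (l k)) ∧
      rho (ε i) (θ i) / tau (ε j * ε k) (l i) = rho (ε j) (θ j) / tau (ε k * ε i) (l j) := by
  obtain rfl : ε = T.type := funext hε
  obtain rfl : θ = T.angle := funext hθ
  obtain rfl : l = T.length := funext hl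
  have hS : 0 < Real.sqrt T.gramDet := Real.sqrt_pos.2 T.gramDet_pos
  refine ⟨fun i => ?_, fun i j k hij hjk hki => ?_⟩
  · rw [T.rho_angle i]
    have := T.minor_pos (i + 1)
    have := T.minor_pos (i + 2)
    positivity
  obtain ⟨a1, a2, a3, a4, a5, a6, hdet⟩ := T.gram_laws hij hjk hki
  obtain ⟨b1, b2, b3, b4, b5, -⟩ := T.gram_laws hjk hki hij
  obtain ⟨c1, c2, c3, c4, c5, -⟩ := T.gram_laws hki hij hjk
  have pi := T.minor_pos i
  have pj := T.minor_pos j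
  have pk := T.minor_pos k
  have hSS : Real.sqrt T.gramDet ^ 2 = T.gramDet := Real.sq_sqrt T.gramDet_pos.le
  rw [a1, a2, b1, b2, c1, c2, a4, a5, a6, b4, b5, c4, c5]
  refine ⟨pi.ne', ?_, rfl, ?_, ?_⟩
  -- After clearing denominators this is the off-diagonal entry of `adj (adj M) = det M • M`: `D c_i
  -- = (c_j c_k - ε_i c_i) t_i² + (c_k c_i - ε_j c_j)(c_i c_j - ε_k c_k)`.
  · have h1 : Real.sqrt T.gramDet / (T.minor k * T.minor i) *
        (Real.sqrt T.gramDet / (T.minor i * T.minor j)) =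
        T.gramDet / (T.minor k * T.minor i ^ 2 * T.minor j) := by
      rw [div_mul_div_comm, ← sq, hSS]
      congr 1
      ring
    have hpos := T.gramDet_pos
    rw [h1, eq_div_iff (by positivity), mul_div_assoc', div_eq_iff (by positivity)]
    have h2 : ((T.gram j * T.gram k - T.type i * T.gram i) / (T.minor j * T.minor k) +
        (T.gram k * T.gram i - T.type j * T.gram j) / (T.minor k * T.minor i) *
        ((T.gram i * T.gram j - T.type k * T.gram k) / (T.minor i * T.minor j))) *
        (T.minor k * T.minor i ^ 2 * T.minor j) =
        (T.gram j * T.gram k - T.type i * T.gram i) * T.minor i ^ 2 +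
        (T.gram k * T.gram i - T.type j * T.gram j) *
          (T.gram i * T.gram j - T.type k * T.gram k) := by
      field_simp
    rw [h2, a3, hdet]
    ring
  · congr 1
    ring
  -- Both ratios equal `√D / (t_i t_j t_k)`.
  · field_simp
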